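/- Let $X$ be a (real or complex) Hilbert space and let $A$ be the infinitesimal generator of a $C_0$-semigroup of contractions $S(t)$, $t\ge 0$, on $X$. Fix $\mu$ in the resolvent set of $A$ and let $X_{-1}$ be the Hilbert space obtained by completing $X$ for the norm $\|x\|_{-1}=\|(\mu-A)^{-1}x\|$ (with inner product $\langle x,y\rangle_{-1}=\langle(\mu-A)^{-1}x,(\mu-A)^{-1}y\rangle$); let $\iota:X\to X_{-1}$ be the canonical embedding (we regard $X\subset X_{-1}$) and let $S_{-1}(t)$ be the continuous extension of $S(t)$ to $X_{-1}$, with generator $A_{-1}$. Let $B\in\mathcal L(X,X_{-1})$, with Hilbert-space adjoint $B^*\in\mathcal L(X_{-1},X)$, and assume that for some $T>0$: (i) there is $1<p<\infty$ such that $\int_0^T S_{-1}(T-s)Bu(s)\,ds\in X$ for all $u\in L^p(0,T;X)$; (ii) there is $\delta>0$ such that $\int_0^T \mathrm{Re}\,\langle S(t)x,B^*S(t)x\rangle_X\,dt\ge\delta\|S(T)x\|_X^2$ for all $x\in X$. Then there is $\rho_1>0$ such that for every $\rho\in(0,\rho_1)$ the system $\dot x(t)=(A_{-1}-\rho B)x(t)$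 is uniformly exponentially stable on $X$: there are constants $K,\sigma>0$ such that for every $x_0\in X$ there is exactly one continuous $x:[0,\infty)\to X$ with $$x(t)=S(t)x_0-\rho\int_0^t S_{-1}(t-s)Bx(s)\,ds\quad\text{in }X_{-1},\qquad t\ge 0,$$ and it satisfies $\|x(t)\|_X\le Ke^{-\sigma t}\|x_0\|_X$ for all $t\ge0$. Moreover, there is a constant $C>0$, independent of $\rho\in(0,\rho_1)$, such that one can take the decay rate $$\sigma=\frac1{2T}\,\ln\frac{\kappa^2+\delta\rho}{\kappa^2+C\rho^2}>0,\qquad \kappa:=\|\iota\|_{\mathcal L(X,X_{-1})}.$$ -/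

import Mathlib

open Filter Topology Set MeasureTheory
open scoped ENNReal

noncomputable section

namespace DeschSchappacher

variable {𝕜 X : Type*} [RCLike 𝕜] [NormedAddCommGroup X] [InnerProductSpace 𝕜 X]

/-- `S` restricted to `[0, ∞)` is a `C₀`-semigroup of bounded operators on `X`
(the values of `S` at negative times are irrelevant). -/
structure IsC0Semigroup (S : ℝ → X →L[𝕜] X) : Prop where
  map_zero : S 0 = ContinuousLinearMap.id 𝕜 X
  map_add : ∀ s t : ℝ, 0 ≤ s → 0 ≤ t → S (s + t) = (S s).comp (S t)
  continuousOn : ∀ x : X, ContinuousOn (fun t : ℝ => S t x) (Ici 0)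

/-- `A` is the infinitesimal generator of `S`: `x ∈ D(A)` and `A x = y` if and only if
`(S(h) x - x) / h → y` as `h → 0+`. -/
def IsGenerator (A : X →ₗ.[𝕜] X) (S : ℝ → X →L[𝕜] X) : Prop :=
  ∀ x y : X, (x, y) ∈ A.graph ↔
    Tendsto (fun h : ℝ => ((h⁻¹ : ℝ) : 𝕜) • (S h x - x)) (𝓝[>] 0) (𝓝 y)

/-- `μ` belongs to the resolvent set of `A`, and the bounded operator `R` is the resolvent
`R(μ, A) = (μ - A)⁻¹`. -/
def IsResolvent (A : X →ₗ.[𝕜] X) (μ : 𝕜) (R : X →L[𝕜] X) : Prop :=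
  (∀ y : X, ∃ h : R y ∈ A.domain, μ • R y - A ⟨R y, h⟩ = y) ∧
    ∀ x : A.domain, R (μ • (x : X) - A x) = x

/-- A copy of the vector space `X`, to be given the (semi)norm `‖R x‖`. -/
def PreExtrapolation (_R : X →L[𝕜] X) : Type _ := X

instance (R : X →L[𝕜] X) : AddCommGroup (PreExtrapolation R) := inferInstanceAs (AddCommGroup X)

instance (R : X →L[𝕜] X) : Module 𝕜 (PreExtrapolation R) := inferInstanceAs (Module 𝕜 X)

/-- The map `x ↦ R x` on the copy of `X`; it induces the inner product `⟪R x, R y⟫`. -/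
def preResolvent (R : X →L[𝕜] X) : PreExtrapolation R →ₗ[𝕜] X where
  toFun x := R (show X from x)
  map_add' x y := R.map_add (show X from x) (show X from y)
  map_smul' c x := R.map_smul c (show X from x)

instance (R : X →L[𝕜] X) : SeminormedAddCommGroup (PreExtrapolation R) :=
  SeminormedAddCommGroup.induced (PreExtrapolation R) X (preResolvent R)

instance (R : X →L[𝕜] X) : InnerProductSpace 𝕜 (PreExtrapolation R) :=
  InnerProductSpace.induced (preResolvent R)

/-- The extrapolation space `X₋₁`: the completion of `X` for the norm `‖x‖₋₁ = ‖R x‖`,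
where `R = R(μ, A)`. -/
def Extrapolation (R : X →L[𝕜] X) : Type _ := UniformSpace.Completion (PreExtrapolation R)

instance (R : X →L[𝕜] X) : NormedAddCommGroup (Extrapolation R) :=
  inferInstanceAs (NormedAddCommGroup (UniformSpace.Completion (PreExtrapolation R)))

instance (R : X →L[𝕜] X) : InnerProductSpace 𝕜 (Extrapolation R) :=
  inferInstanceAs (InnerProductSpace 𝕜 (UniformSpace.Completion (PreExtrapolation R)))

instance (R : X →L[𝕜] X) : CompleteSpace (Extrapolation R) :=
  inferInstanceAs (CompleteSpace (UniformSpace.Completion (PreExtrapolation R)))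

/-- `X₋₁` as a real normed space, as needed for the Bochner integral. -/
instance (R : X →L[𝕜] X) : NormedSpace ℝ (Extrapolation R) :=
  NormedSpace.restrictScalars ℝ 𝕜 (Extrapolation R)

theorem norm_preExtrapolation (R : X →L[𝕜] X) (x : X) :
    ‖(show PreExtrapolation R from x)‖ = ‖R x‖ := rfl

/-- The canonical embedding `X → X₋₁`. -/
def embed (R : X →L[𝕜] X) : X →L[𝕜] Extrapolation R :=
  LinearMap.mkContinuous
    { toFun := fun x =>
        (((show PreExtrapolation R from x) : UniformSpace.Completion (PreExtrapolation R)))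
      map_add' := fun x y => UniformSpace.Completion.coe_add
        (show PreExtrapolation R from x) (show PreExtrapolation R from y)
      map_smul' := fun c x => UniformSpace.Completion.coe_smul c
        (show PreExtrapolation R from x) }
    ‖R‖
    (fun x => (UniformSpace.Completion.norm_coe (show PreExtrapolation R from x)).trans_le
      (R.le_opNorm x))

theorem norm_embed_apply (R : X →L[𝕜] X) (x : X) : ‖embed R x‖ = ‖R x‖ :=
  UniformSpace.Completion.norm_coe (show PreExtrapolation R from x)

theorem inner_embed_apply (R : X →L[𝕜] X) (x y : X) :
    inner 𝕜 (embed R x) (embed R y) = inner 𝕜 (R x) (R y) :=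
  UniformSpace.Completion.inner_coe (show PreExtrapolation R from x)
    (show PreExtrapolation R from y)

theorem denseRange_embed (R : X →L[𝕜] X) : DenseRange (embed R) :=
  UniformSpace.Completion.denseRange_coe (α := PreExtrapolation R)

/-- The operator on `X₋₁` extending `V ∈ L(X)` by uniform continuity; applied to `V = S t` it is
`S₋₁(t)`. -/
def extend (R V : X →L[𝕜] X) : Extrapolation R → Extrapolation R :=
  UniformSpace.Completion.map (α := PreExtrapolation R) (β := PreExtrapolation R)
    (fun x => V (show X from x))

/-- The resolvent commutes with the semigroup. -/
theorem resolvent_comm {S : ℝ → X →L[𝕜] X} {A : X →ₗ.[𝕜] X} {μ : 𝕜} {R : X →L[𝕜] X}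
    (hS : IsC0Semigroup S) (hA : IsGenerator A S) (hR : IsResolvent A μ R)
    {t : ℝ} (ht : 0 ≤ t) (x : X) : R (S t x) = S t (R x) := by
  obtain ⟨h, hx⟩ := hR.1 x
  have h1 : (R x, A ⟨R x, h⟩) ∈ A.graph := A.mem_graph ⟨R x, h⟩
  have h2 := ((S t).continuous.tendsto _).comp ((hA _ _).1 h1)
  have h3 : (S t (R x), S t (A ⟨R x, h⟩)) ∈ A.graph := by
    refine (hA _ _).2 (h2.congr' ?_)
    filter_upwards [self_mem_nhdsWithin] with s hs
    have hs' : (0 : ℝ) ≤ s := le_of_lt hs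
    have e : S s (S t (R x)) = S t (S s (R x)) := by
      have e1 := congrArg (fun V : X →L[𝕜] X => V (R x)) (hS.map_add s t hs' ht)
      have e2 := congrArg (fun V : X →L[𝕜] X => V (R x)) (hS.map_add t s ht hs')
      simp only [ContinuousLinearMap.comp_apply] at e1 e2
      rw [← e1, ← e2, add_comm]
    simp only [Function.comp_apply, map_smul, map_sub, e]
  obtain ⟨z, hz1, hz2⟩ := A.mem_graph_iff.1 h3
  have h4 := hR.2 z
  simp only at hz1 hz2
  rw [hz1, hz2, ← map_smul, ← map_sub, hx] at h4
  exact h4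

/-- `extend R V` is uniformly continuous and extends `V` whenever `V` commutes with `R`. -/
theorem extend_embed {R V : X →L[𝕜] X} (h : ∀ x, R (V x) = V (R x)) (x : X) :
    extend R V (embed R x) = embed R (V x) := by
  have hu : UniformContinuous
      (fun x : PreExtrapolation R => (show PreExtrapolation R from V (show X from x))) := by
    let L : PreExtrapolation R →ₗ[𝕜] PreExtrapolation R :=
      { toFun := fun x => V (show X from x)
        map_add' := fun x y => V.map_add (show X from x) (show X from y)
        map_smul' := fun c x => V.map_smul c (show X from x) }
    refine (LinearMap.mkContinuous L ‖V‖ fun x => ?_).uniformContinuous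
    change ‖R (V (show X from x))‖ ≤ ‖V‖ * ‖R (show X from x)‖
    rw [h]
    exact V.le_opNorm _
  exact UniformSpace.Completion.map_coe hu (show PreExtrapolation R from x)

/-- The `X₋₁`-valued Bochner integral `∫₀ᵗ S₋₁(t - s) B u(s) ds`. -/
def convolution (S : ℝ → X →L[𝕜] X) {R : X →L[𝕜] X} (B : X →L[𝕜] Extrapolation R)
    (u : ℝ → X) (t : ℝ) : Extrapolation R :=
  ∫ s in (0 : ℝ)..t, extend R (S (t - s)) (B (u s))

/-- `p`-admissibility of `B ∈ L(X, X₋₁)` on `[0, T]`: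
`∫₀ᵀ S₋₁(T - s) B u(s) ds ∈ X` for all `u ∈ Lᵖ(0, T; X)`. -/
def IsAdmissible (S : ℝ → X →L[𝕜] X) {R : X →L[𝕜] X} (B : X →L[𝕜] Extrapolation R)
    (p : ℝ≥0∞) (T : ℝ) : Prop :=
  ∀ u : ℝ → X, MemLp u p (volume.restrict (Ioc 0 T)) → convolution S B u T ∈ range (embed R)

/-- `x : [0, ∞) → X` is a (global, `X`-valued) mild solution of
`x'(t) = (A₋₁ - ρ B) x(t)`, `x(0) = x₀`. -/
def IsMildSolution (S : ℝ → X →L[𝕜] X) {R : X →L[𝕜] X} (B : X →L[𝕜] Extrapolation R)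
    (ρ : ℝ) (x₀ : X) (x : ℝ → X) : Prop :=
  ContinuousOn x (Ici 0) ∧
    ∀ t : ℝ, 0 ≤ t → embed R (x t) = embed R (S t x₀) - ρ • convolution S B x t

/-- Uniform exponential stability with rate `σ`: every initial state has exactly one
mild solution on `[0, ∞)`, and `‖x(t)‖ ≤ K e^{-σ t} ‖x₀‖` with `K` independent of `x₀`. -/
def IsExponentiallyStable (S : ℝ → X →L[𝕜] X) {R : X →L[𝕜] X} (B : X →L[𝕜] Extrapolation R)
    (ρ σ : ℝ) : Prop :=
  ∃ K : ℝ, 0 < K ∧ ∀ x₀ : X, ∃ x : ℝ → X, IsMildSolution S B ρ x₀ x ∧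
    (∀ y : ℝ → X, IsMildSolution S B ρ x₀ y → EqOn y x (Ici 0)) ∧
    ∀ t : ℝ, 0 ≤ t → ‖x t‖ ≤ K * Real.exp (-σ * t) * ‖x₀‖

end DeschSchappacher

end

/-!
Let `ι : X → X₋₁` be the embedding. The form `⟪x, B* x⟫_X` in the observability hypothesis is
the `X₋₁` inner product `⟪B x, ι x⟫`, so it is the `X₋₁`-norm that the feedback dissipates. Since
`S₋₁` is again a semigroup of contractions, a mild solution satisfies
`‖ι x(T)‖² ≤ ‖ι x₀‖² - 2ρ ∫₀ᵀ re ⟪B x, ι x⟫` (`IsContractionSemigroup.norm_sq_le`).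

By the closed graph theorem, admissibility gives a bound `N` for the Duhamel integrals of `B u` in
`X` over `[0, T]`, in terms of `sup ‖u‖` (`IsContractionSemigroup.exists_duhamelBound`). Hence, for
`ρ N ≤ 1/2`, the mild equation is solved by a contraction on `C([0, T], X)`, with `‖x(t)‖ ≤ 2‖x₀‖`
and `‖x(t) - S(t) x₀‖ ≤ 2ρN‖x₀‖`, and solutions on `[0, T]` concatenate to global ones
(`IsPerturbation.exists_isMildOn`, `IsPerturbation.exists_isMildOn_forall`).

Replacing `x(t)` by `S(t) x₀` in the dissipation integral costs `O(ρ)‖x₀‖²`, so observability gives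
`‖ι x(T)‖² + δρ‖x(T)‖² ≤ ‖ι x₀‖² + Cρ²‖x₀‖²` (`IsPerturbation.energy_le`). With
`V(v) = ‖ι v‖² + δρ‖v‖²`, an equivalent squared norm on `X`, and `‖ι v‖ ≤ κ‖v‖`, this reads
`V(x(T)) ≤ θ V(x₀)` for `θ = (κ² + Cρ²) / (κ² + δρ)`, and `θ < 1` as soon as `Cρ < δ`. Iterating over
the periods gives the decay rate `-(log θ) / (2T)` (`IsPerturbation.exists_decay`).
-/

noncomputable section

namespace DeschSchappacher

/-! ### Duhamel integrals of a contraction semigroup -/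

section Duhamel

variable {𝕜 E : Type*} [RCLike 𝕜] [NormedAddCommGroup E] [InnerProductSpace 𝕜 E]

/-- `F` restricted to `[0, ∞)` is a semigroup of contractions, and `(t, y) ↦ F t y` is continuous
and contractive on all of `ℝ × E`. A contraction semigroup on `[0, ∞)` is brought into this form by
setting `F t = 1` for `t < 0`; this makes `s ↦ F (t - s) (f s)` continuous on all of `ℝ`. -/
structure IsContractionSemigroup (F : ℝ → E →L[𝕜] E) : Prop where
  map_zero : ∀ y, F 0 y = y
  map_add : ∀ s t : ℝ, 0 ≤ s → 0 ≤ t → ∀ y, F (s + t) y = F s (F t y)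
  norm_le : ∀ t y, ‖F t y‖ ≤ ‖y‖
  cont : Continuous fun q : ℝ × E => F q.1 q.2

theorem IsContractionSemigroup.continuousOn_integrand {F : ℝ → E →L[𝕜] E}
    (hF : IsContractionSemigroup F) {f : ℝ → E} {s : Set ℝ} (hf : ContinuousOn f s) (t : ℝ) :
    ContinuousOn (fun r => F (t - r) (f r)) s :=
  hF.cont.comp_continuousOn ((continuousOn_const.sub continuousOn_id).prodMk hf)

theorem IsContractionSemigroup.intervalIntegrable {F : ℝ → E →L[𝕜] E}
    (hF : IsContractionSemigroup F) {f : ℝ → E} {a b : ℝ} (hab : a ≤ b)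
    (hf : ContinuousOn f (Icc a b)) (t : ℝ) :
    IntervalIntegrable (fun r => F (t - r) (f r)) volume a b :=
  ContinuousOn.intervalIntegrable (by
    rw [uIcc_of_le hab]; exact hF.continuousOn_integrand hf t)

variable [NormedSpace ℝ E]

/-- The Duhamel integral `∫₀ᵗ F(t - s) f(s) ds`. -/
def duhamel (F : ℝ → E →L[𝕜] E) (f : ℝ → E) (t : ℝ) : E :=
  ∫ s in (0 : ℝ)..t, F (t - s) (f s)

theorem duhamel_zero (F : ℝ → E →L[𝕜] E) (f : ℝ → E) : duhamel F f 0 = 0 := by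
  simp [duhamel]

theorem duhamel_congr (F : ℝ → E →L[𝕜] E) {f g : ℝ → E} {t : ℝ} (ht : 0 ≤ t)
    (h : EqOn f g (Icc 0 t)) : duhamel F f t = duhamel F g t := by
  refine intervalIntegral.integral_congr fun s hs => ?_
  rw [uIcc_of_le ht] at hs
  simp only [h hs]

theorem IsContractionSemigroup.duhamel_sub {F : ℝ → E →L[𝕜] E}
    (hF : IsContractionSemigroup F) {f g : ℝ → E} {t : ℝ} (ht : 0 ≤ t)
    (hf : ContinuousOn f (Icc 0 t)) (hg : ContinuousOn g (Icc 0 t)) :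
    duhamel F (fun s => f s - g s) t = duhamel F f t - duhamel F g t := by
  simp only [duhamel, map_sub]
  exact intervalIntegral.integral_sub (hF.intervalIntegrable ht hf t)
    (hF.intervalIntegrable ht hg t)

theorem duhamel_smul [IsScalarTower ℝ 𝕜 E] (F : ℝ → E →L[𝕜] E) (c : ℝ) (f : ℝ → E) (t : ℝ) :
    duhamel F (fun s => c • f s) t = c • duhamel F f t := by
  simp only [duhamel, RCLike.real_smul_eq_coe_smul (K := 𝕜) c, map_smul]
  simp only [← RCLike.real_smul_eq_coe_smul (K := 𝕜) c]
  exact intervalIntegral.integral_smul _ _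

/-- The cocycle property: the Duhamel integral restarts at any intermediate time. -/
theorem IsContractionSemigroup.duhamel_add [CompleteSpace E] {F : ℝ → E →L[𝕜] E}
    (hF : IsContractionSemigroup F) {f : ℝ → E} {a b : ℝ} (ha : 0 ≤ a) (hb : 0 ≤ b)
    (hf : ContinuousOn f (Icc 0 (a + b))) :
    duhamel F f (a + b) = F b (duhamel F f a) + duhamel F (fun s => f (a + s)) b := by
  have h1 : ContinuousOn f (Icc 0 a) := hf.mono (Icc_subset_Icc_right (by linarith))
  have h2 : ContinuousOn f (Icc a (a + b)) := hf.mono (Icc_subset_Icc_left ha)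
  unfold duhamel
  rw [← intervalIntegral.integral_add_adjacent_intervals (hF.intervalIntegrable ha h1 (a + b))
    (hF.intervalIntegrable (by linarith) h2 (a + b)),
    ← ContinuousLinearMap.intervalIntegral_comp_comm (F b) (hF.intervalIntegrable ha h1 a)]
  congr 1
  · refine intervalIntegral.integral_congr fun s hs => ?_
    rw [uIcc_of_le ha] at hs
    rw [← hF.map_add b (a - s) hb (by linarith [hs.2]), show b + (a - s) = a + b - s by ring]
  · have := intervalIntegral.integral_comp_add_left (a := 0) (b := b)
      (fun r => F (a + b - r) (f r)) a
    rw [add_zero] at this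
    rw [← this]
    refine intervalIntegral.integral_congr fun s _ => ?_
    simp only [show a + b - (a + s) = b - s by ring]

theorem IsContractionSemigroup.continuous_duhamel {F : ℝ → E →L[𝕜] E}
    (hF : IsContractionSemigroup F) {f : ℝ → E} (hf : Continuous f) :
    Continuous (duhamel F f) := by
  refine intervalIntegral.continuous_parametric_intervalIntegral_of_continuous
    (f := fun t s => F (t - s) (f s)) ?_ continuous_id
  exact hF.cont.comp ((continuous_fst.sub continuous_snd).prodMk (hf.comp continuous_snd))

theorem IsContractionSemigroup.tendsto_inv_smul_duhamel [CompleteSpace E] {F : ℝ → E →L[𝕜] E}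
    (hF : IsContractionSemigroup F) {f : ℝ → E} (hf : Continuous f) :
    Tendsto (fun h : ℝ => h⁻¹ • duhamel F f h) (𝓝[>] 0) (𝓝 (f 0)) := by
  rw [Metric.tendsto_nhds]
  intro ε hε
  have hc : Continuous fun q : ℝ × ℝ => F (q.1 - q.2) (f q.2) :=
    hF.cont.comp ((continuous_fst.sub continuous_snd).prodMk (hf.comp continuous_snd))
  obtain ⟨η, hη, hη'⟩ := Metric.continuousAt_iff.1 (hc.continuousAt (x := (0, 0))) (ε / 2)
    (half_pos hε)
  filter_upwards [Ioo_mem_nhdsGT hη] with h hh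
  have key : ‖duhamel F f h - h • f 0‖ ≤ ε / 2 * |h - 0| := by
    have e : duhamel F f h - h • f 0 = ∫ s in (0 : ℝ)..h, (F (h - s) (f s) - f 0) := by
      rw [intervalIntegral.integral_sub (hF.intervalIntegrable hh.1.le hf.continuousOn h)
        intervalIntegrable_const]
      simp [duhamel]
    rw [e]
    refine intervalIntegral.norm_integral_le_of_norm_le_const fun s hs => ?_
    rw [uIoc_of_le hh.1.le] at hs
    have hd : dist ((h, s) : ℝ × ℝ) (0, 0) < η := by
      rw [Prod.dist_eq, max_lt_iff, Real.dist_eq, Real.dist_eq, sub_zero, sub_zero,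
        abs_of_pos hh.1, abs_of_pos hs.1]
      exact ⟨hh.2, hs.2.trans_lt hh.2⟩
    have := hη' hd
    simp only [sub_zero, hF.map_zero, dist_eq_norm] at this
    exact this.le
  have e2 : h⁻¹ • duhamel F f h - f 0 = h⁻¹ • (duhamel F f h - h • f 0) := by
    rw [smul_sub, inv_smul_smul₀ hh.1.ne']
  rw [dist_eq_norm, e2, norm_smul, norm_inv, Real.norm_eq_abs]
  rw [sub_zero] at key
  have hp : 0 < |h| := abs_pos.2 hh.1.ne'
  calc |h|⁻¹ * ‖duhamel F f h - h • f 0‖ ≤ |h|⁻¹ * (ε / 2 * |h|) := by gcongr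
    _ = ε / 2 := by field_simp
    _ < ε := half_lt_self hε

/-- The energy inequality for `w' = G w + f`, where `G` is the (dissipative) generator of `F`.
A mild solution need not be differentiable, but `w (t + h) = F h (w t) + h f(t) + o(h)` and
`‖F h (w t)‖ ≤ ‖w t‖` bound the upper right Dini derivative of `‖w‖²` by `2 re ⟪w, f⟫`. -/
theorem IsContractionSemigroup.norm_sq_le [CompleteSpace E] [IsScalarTower ℝ 𝕜 E]
    {F : ℝ → E →L[𝕜] E} (hF : IsContractionSemigroup F) {f : ℝ → E} (hf : Continuous f)
    (w₀ : E) {w : ℝ → E} (hw : Continuous w)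
    {T : ℝ} (hT : 0 ≤ T) (hweq : ∀ t ∈ Icc 0 T, w t = F t w₀ + duhamel F f t) :
    ‖w T‖ ^ 2 ≤ ‖w₀‖ ^ 2 + ∫ t in (0 : ℝ)..T, 2 * RCLike.re (inner 𝕜 (w t) (f t)) := by
  have hcont : Continuous fun t => 2 * RCLike.re (inner 𝕜 (w t) (f t)) :=
    continuous_const.mul (RCLike.continuous_re.comp (hw.inner hf))
  have hder : ∀ t, HasDerivAt
      (fun t => ‖w₀‖ ^ 2 + ∫ s in (0 : ℝ)..t, 2 * RCLike.re (inner 𝕜 (w s) (f s)))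
      (2 * RCLike.re (inner 𝕜 (w t) (f t))) t := fun t =>
    (intervalIntegral.integral_hasDerivAt_right (hcont.intervalIntegrable _ _)
      (hcont.stronglyMeasurableAtFilter _ _) hcont.continuousAt).const_add _
  refine image_le_of_liminf_slope_right_le_deriv_boundary (a := 0) (b := T)
    (f := fun t => ‖w t‖ ^ 2)
    (B := fun t => ‖w₀‖ ^ 2 + ∫ s in (0 : ℝ)..t, 2 * RCLike.re (inner 𝕜 (w s) (f s)))
    (B' := fun t => 2 * RCLike.re (inner 𝕜 (w t) (f t)))
    (hw.norm.pow 2).continuousOn ?_ (fun t _ => (hder t).continuousAt.continuousWithinAt)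
    (fun t _ => (hder t).hasDerivWithinAt) ?_ (right_mem_Icc.2 hT)
  · simp [hweq 0 (left_mem_Icc.2 hT), hF.map_zero, duhamel_zero]
  intro t ht r hr
  set f' : ℝ → E := fun s => f (t + s) with hf'
  have hf'c : Continuous f' := hf.comp (continuous_const.add continuous_id)
  have hstep : ∀ h, 0 < h → t + h ≤ T → w (t + h) = F h (w t) + duhamel F f' h := by
    intro h hh hhT
    rw [hweq (t + h) ⟨by linarith [ht.1], hhT⟩, hweq t ⟨ht.1, ht.2.le⟩, _root_.map_add,
      hF.duhamel_add ht.1 hh.le hf.continuousOn, add_comm t h, hF.map_add h t hh.le ht.1, add_assoc]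
  have hlim1 := hF.tendsto_inv_smul_duhamel hf'c
  have hFlim : Tendsto (fun h => F h (w t)) (𝓝[>] 0) (𝓝 (w t)) := by
    have : Continuous fun h => F h (w t) :=
      hF.cont.comp (continuous_id.prodMk continuous_const)
    have h0 := this.tendsto 0
    rw [hF.map_zero] at h0
    exact h0.mono_left nhdsWithin_le_nhds
  have hdlim : Tendsto (fun h => duhamel F f' h) (𝓝[>] 0) (𝓝 0) := by
    have h0 := (hF.continuous_duhamel hf'c).tendsto 0
    rw [duhamel_zero] at h0
    exact h0.mono_left nhdsWithin_le_nhds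
  have hlim : Tendsto (fun h : ℝ => 2 * RCLike.re (inner 𝕜 (F h (w t)) (h⁻¹ • duhamel F f' h))
      + ‖duhamel F f' h‖ * ‖h⁻¹ • duhamel F f' h‖) (𝓝[>] 0)
      (𝓝 (2 * RCLike.re (inner 𝕜 (w t) (f t)))) := by
    have h1 := ((RCLike.continuous_re.tendsto _).comp (Tendsto.inner (𝕜 := 𝕜) hFlim hlim1)).const_mul 2
    have h2 := hdlim.norm.mul hlim1.norm
    have := h1.add h2
    simpa [hf'] using this
  have hshift : Tendsto (fun z => z - t) (𝓝[>] t) (𝓝[>] 0) := by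
    refine tendsto_nhdsWithin_iff.2 ⟨?_, ?_⟩
    · have : Tendsto (fun z => z - t) (𝓝 t) (𝓝 (t - t)) :=
        (continuous_id.sub continuous_const).tendsto t
      rw [sub_self] at this
      exact this.mono_left nhdsWithin_le_nhds
    · filter_upwards [self_mem_nhdsWithin] with z hz
      exact sub_pos.2 (mem_Ioi.1 hz)
  refine Eventually.frequently ?_
  filter_upwards [(hlim.comp hshift).eventually (gt_mem_nhds hr), Ioo_mem_nhdsGT ht.2] with z hz hzT
  refine lt_of_le_of_lt ?_ hz
  have hh : 0 < z - t := sub_pos.2 hzT.1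
  simp only [Function.comp_apply]
  set h := z - t with hdef
  have hz' : z = t + h := by rw [hdef]; ring
  have e := hstep h hh (by rw [← hz']; exact hzT.2.le)
  rw [slope_def_field, hz', e, add_sub_cancel_left, div_le_iff₀ hh,
    RCLike.real_smul_eq_coe_smul (K := 𝕜) h⁻¹, inner_smul_right, RCLike.re_ofReal_mul, norm_smul,
    RCLike.norm_ofReal, abs_of_pos (inv_pos.2 hh), norm_add_sq (𝕜 := 𝕜)]
  have hn : ‖F h (w t)‖ ^ 2 ≤ ‖w t‖ ^ 2 := by
    gcongr; exact hF.norm_le _ _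
  have e3 : (2 * (h⁻¹ * RCLike.re (inner 𝕜 (F h (w t)) (duhamel F f' h))) +
      ‖duhamel F f' h‖ * (h⁻¹ * ‖duhamel F f' h‖)) * h =
      2 * RCLike.re (inner 𝕜 (F h (w t)) (duhamel F f' h)) + ‖duhamel F f' h‖ ^ 2 := by
    field_simp
  rw [e3]
  linarith

end Duhamel

/-! ### Admissibility as an estimate -/

section Admissible

variable {𝕜 X E : Type*} [RCLike 𝕜] [NormedAddCommGroup X] [NormedSpace 𝕜 X]
  [NormedAddCommGroup E] [InnerProductSpace 𝕜 E]

theorem IsContractionSemigroup.aestronglyMeasurable_integrand {F : ℝ → E →L[𝕜] E}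
    (hF : IsContractionSemigroup F) (B : X →L[𝕜] E) {u : ℝ → X} {ν : Measure ℝ}
    (hu : AEStronglyMeasurable u ν) (t : ℝ) :
    AEStronglyMeasurable (fun s => F (t - s) (B (u s))) ν :=
  hF.cont.comp_aestronglyMeasurable
    ((continuous_const.sub continuous_id).aestronglyMeasurable.prodMk
      (B.continuous.comp_aestronglyMeasurable hu))

theorem IsContractionSemigroup.integrable_integrand {F : ℝ → E →L[𝕜] E}
    (hF : IsContractionSemigroup F) (B : X →L[𝕜] E) {u : ℝ → X} {ν : Measure ℝ}
    (hu : Integrable u ν) (t : ℝ) :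
    Integrable (fun s => F (t - s) (B (u s))) ν :=
  (hu.norm.const_mul ‖B‖).mono' (hF.aestronglyMeasurable_integrand B hu.1 t)
    (ae_of_all _ fun _ => (hF.norm_le _ _).trans (B.le_opNorm _))

variable [NormedSpace ℝ E]

/-- For continuous `u` and `t ∈ [0, T]` the Duhamel integral of `B u` at time `t` lies in the range
of `ι`, and its preimage is bounded by `M tᵠ sup ‖u‖`. The factor `tᵠ`, with `q > 0`, is what makes
these preimages continuous in `t`. -/
def DuhamelBound (ι : X →L[𝕜] E) (F : ℝ → E →L[𝕜] E) (B : X →L[𝕜] E) (T M q : ℝ) : Prop :=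
  ∀ u : ℝ → X, Continuous u → ∀ t ∈ Icc 0 T, ∀ c : ℝ, 0 ≤ c → (∀ s ∈ Icc 0 t, ‖u s‖ ≤ c) →
    ∃ v : X, ι v = duhamel F (fun s => B (u s)) t ∧ ‖v‖ ≤ M * t ^ q * c

/-- The closed graph theorem turns admissibility into boundedness: the input map
`u ↦ ∫₀ᵀ F(T - s) B u(s) ds` is bounded from `Lᵖ` to `E` and takes values in the range of the
injection `ι`, so it is bounded from `Lᵖ` to `X`. -/
theorem IsContractionSemigroup.exists_inputMap [CompleteSpace X] [CompleteSpace E]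
    [IsScalarTower ℝ 𝕜 E] {F : ℝ → E →L[𝕜] E}
    (hF : IsContractionSemigroup F) {ι : X →L[𝕜] E} (hι : Function.Injective ι)
    (B : X →L[𝕜] E) {T : ℝ} (hT : 0 ≤ T) {p : ℝ≥0∞} [Fact (1 ≤ p)]
    (hadm : ∀ u : ℝ → X, MemLp u p (volume.restrict (Ioc 0 T)) →
      duhamel F (fun s => B (u s)) T ∈ range ι) :
    ∃ Ψ : Lp X p (volume.restrict (Ioc 0 T)) →L[𝕜] X, ∀ u,
      ι (Ψ u) = duhamel F (fun s => B (u s)) T := by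
  set ν := volume.restrict (Ioc (0 : ℝ) T)
  have hp : 1 ≤ p := Fact.out
  have hint : ∀ u : Lp X p ν, Integrable (fun s => F (T - s) (B (u s))) ν := fun u =>
    hF.integrable_integrand B ((Lp.memLp u).integrable hp) T
  have hJ : ∀ u : ℝ → X, duhamel F (fun s => B (u s)) T = ∫ s, F (T - s) (B (u s)) ∂ν :=
    fun u => intervalIntegral.integral_of_le hT
  have hbound : ∀ u : Lp X p ν, ‖∫ s, F (T - s) (B (u s)) ∂ν‖ ≤
      ‖B‖ * (ν univ ^ (1 / (1 : ℝ≥0∞).toReal - 1 / p.toReal)).toReal * ‖u‖ := by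
    intro u
    have h1 : ∫ s, ‖u s‖ ∂ν ≤
        ‖u‖ * (ν univ ^ (1 / (1 : ℝ≥0∞).toReal - 1 / p.toReal)).toReal := by
      rw [integral_norm_eq_lintegral_enorm (Lp.aestronglyMeasurable u),
        ← eLpNorm_one_eq_lintegral_enorm, Lp.norm_def, ← ENNReal.toReal_mul]
      refine ENNReal.toReal_mono (ENNReal.mul_ne_top (Lp.eLpNorm_ne_top u) ?_)
        (eLpNorm_le_eLpNorm_mul_rpow_measure_univ hp (Lp.aestronglyMeasurable u))
      refine ENNReal.rpow_ne_top_of_nonneg ?_ (measure_ne_top _ _)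
      rw [ENNReal.toReal_one, sub_nonneg, one_div_one]
      rcases eq_or_ne p ∞ with rfl | hp'
      · simp
      · have : (1 : ℝ) ≤ p.toReal := by
          rw [← ENNReal.toReal_one]; exact ENNReal.toReal_mono hp' hp
        exact (div_le_one (by linarith)).2 this
    calc ‖∫ s, F (T - s) (B (u s)) ∂ν‖ ≤ ∫ s, ‖B‖ * ‖u s‖ ∂ν :=
          norm_integral_le_of_norm_le (((Lp.memLp u).integrable hp).norm.const_mul _)
            (ae_of_all _ fun _ => (hF.norm_le _ _).trans (B.le_opNorm _))
      _ = ‖B‖ * ∫ s, ‖u s‖ ∂ν := integral_const_mul _ _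
      _ ≤ ‖B‖ * (‖u‖ * (ν univ ^ (1 / (1 : ℝ≥0∞).toReal - 1 / p.toReal)).toReal) := by gcongr
      _ = _ := by ring
  let J : Lp X p ν →L[𝕜] E := LinearMap.mkContinuous
    { toFun := fun u => ∫ s, F (T - s) (B (u s)) ∂ν
      map_add' := fun u v => by
        rw [← integral_add (hint u) (hint v)]
        refine integral_congr_ae ?_
        filter_upwards [Lp.coeFn_add u v] with s hs
        rw [hs, Pi.add_apply, _root_.map_add, _root_.map_add]
      map_smul' := fun c u => by
        rw [RingHom.id_apply, ← integral_smul]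
        refine integral_congr_ae ?_
        filter_upwards [Lp.coeFn_smul c u] with s hs
        rw [hs, Pi.smul_apply, map_smul, map_smul] }
    _ hbound
  have hJu : ∀ u : Lp X p ν, J u = duhamel F (fun s => B (u s)) T := fun u => (hJ u).symm
  have hex : ∀ u : Lp X p ν, ∃ v, ι v = J u := fun u => by
    rw [hJu]; exact hadm u (Lp.memLp u)
  choose ψ hψ using hex
  let Ψ : Lp X p ν →ₗ[𝕜] X :=
    { toFun := ψ
      map_add' := fun u v => hι (by rw [_root_.map_add, hψ, hψ, hψ, _root_.map_add])
      map_smul' := fun c u => hι (by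
        rw [map_smul, hψ, hψ, map_smul, RingHom.id_apply]) }
  have hΨ : Continuous Ψ := by
    refine Ψ.continuous_of_seq_closed_graph fun u x y hu hy => hι ?_
    have h1 := (ι.continuous.tendsto y).comp hy
    have h2 := (J.continuous.tendsto x).comp hu
    have h3 : (ι ∘ (Ψ ∘ u)) = J ∘ u := funext fun n => hψ (u n)
    rw [h3] at h1
    exact (tendsto_nhds_unique h1 h2).trans (hψ x).symm
  exact ⟨⟨Ψ, hΨ⟩, fun u => (hψ u).trans (hJu u)⟩

/-- Delaying an input by `T - t` turns its Duhamel integral at time `t` into one at time `T`. -/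
theorem duhamel_delay (F : ℝ → E →L[𝕜] E) (f : ℝ → E) {t T : ℝ} (ht : t ∈ Icc 0 T) :
    duhamel F ((Ioi (T - t)).indicator fun s => f (s - (T - t))) T = duhamel F f t := by
  have e : ∀ s, F (T - s) ((Ioi (T - t)).indicator (fun s => f (s - (T - t))) s) =
      (Ioi (T - t)).indicator (fun s => F (T - s) (f (s - (T - t)))) s := by
    intro s
    by_cases hs : s ∈ Ioi (T - t)
    · simp only [indicator_of_mem hs]
    · simp only [indicator_of_notMem hs, _root_.map_zero]
  have e2 : Ioc 0 T ∩ Ioi (T - t) = Ioc (T - t) T := by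
    ext s
    simp only [mem_inter_iff, mem_Ioc, mem_Ioi]
    constructor
    · rintro ⟨⟨_, h2⟩, h3⟩; exact ⟨h3, h2⟩
    · rintro ⟨h3, h2⟩; exact ⟨⟨by linarith [ht.2], h2⟩, h3⟩
  unfold duhamel
  simp only [e]
  rw [intervalIntegral.integral_of_le (ht.1.trans ht.2), setIntegral_indicator measurableSet_Ioi,
    e2, ← intervalIntegral.integral_of_le (by linarith [ht.1])]
  have := intervalIntegral.integral_comp_add_left (a := 0) (b := t)
    (fun s => F (T - s) (f (s - (T - t)))) (T - t)
  rw [add_zero, sub_add_cancel] at this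
  rw [← this]
  refine intervalIntegral.integral_congr fun s _ => ?_
  simp only [show T - (T - t + s) = t - s by ring, add_sub_cancel_left]

/-- Admissibility at the single time `T` controls all earlier times, by delaying the input; since the
delayed input lives on an interval of length `t`, its `Lᵖ`-norm is at most `t^(1/p) sup ‖u‖`. This
is where `p < ∞` enters. -/
theorem IsContractionSemigroup.exists_duhamelBound [CompleteSpace X] [CompleteSpace E]
    [IsScalarTower ℝ 𝕜 E] {F : ℝ → E →L[𝕜] E}
    (hF : IsContractionSemigroup F) {ι : X →L[𝕜] E} (hι : Function.Injective ι)
    (B : X →L[𝕜] E) {T : ℝ} (hT : 0 ≤ T) {p : ℝ≥0∞} (hp : 1 ≤ p) (hp' : p < ∞)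
    (hadm : ∀ u : ℝ → X, MemLp u p (volume.restrict (Ioc 0 T)) →
      duhamel F (fun s => B (u s)) T ∈ range ι) :
    ∃ M, 0 ≤ M ∧ ∃ q, 0 < q ∧ DuhamelBound ι F B T M q := by
  have : Fact (1 ≤ p) := ⟨hp⟩
  set ν := volume.restrict (Ioc (0 : ℝ) T)
  obtain ⟨Ψ, hΨ⟩ := hF.exists_inputMap hι B hT hadm
  have hq : 0 < p.toReal⁻¹ :=
    inv_pos.2 (ENNReal.toReal_pos (zero_lt_one.trans_le hp).ne' hp'.ne)
  refine ⟨‖Ψ‖, norm_nonneg _, p.toReal⁻¹, hq, ?_⟩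
  intro u hu t ht c hc hb
  set u' : ℝ → X := (Ioi (T - t)).indicator fun s => u (s - (T - t)) with hu'
  have hmeas : AEStronglyMeasurable (fun s => u (s - (T - t))) ν :=
    (hu.comp (continuous_id.sub continuous_const)).aestronglyMeasurable
  have hnorm : eLpNorm u' p ν ≤ ENNReal.ofReal t ^ p.toReal⁻¹ * ENNReal.ofReal c := by
    have e2 : Ioi (T - t) ∩ Ioc 0 T = Ioc (T - t) T := by
      ext s
      simp only [mem_inter_iff, mem_Ioc, mem_Ioi]
      constructor
      · rintro ⟨h3, ⟨_, h2⟩⟩; exact ⟨h3, h2⟩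
      · rintro ⟨h3, h2⟩; exact ⟨h3, ⟨by linarith [ht.2], h2⟩⟩
    rw [hu', eLpNorm_indicator_eq_eLpNorm_restrict measurableSet_Ioi,
      Measure.restrict_restrict measurableSet_Ioi, e2]
    have := eLpNorm_le_of_ae_bound (p := p) (μ := volume.restrict (Ioc (T - t) T)) (C := c)
      (f := fun s => u (s - (T - t))) (by
        filter_upwards [ae_restrict_mem measurableSet_Ioc] with s hs
        exact hb _ ⟨by linarith [hs.1], by linarith [hs.2]⟩)
    rwa [Measure.restrict_apply_univ, Real.volume_Ioc, sub_sub_cancel] at this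
  have hfin : ENNReal.ofReal t ^ p.toReal⁻¹ * ENNReal.ofReal c ≠ ∞ :=
    ENNReal.mul_ne_top (ENNReal.rpow_ne_top_of_nonneg hq.le ENNReal.ofReal_ne_top)
      ENNReal.ofReal_ne_top
  have hmem : MemLp u' p ν :=
    ⟨hmeas.indicator measurableSet_Ioi, hnorm.trans_lt (lt_top_iff_ne_top.2 hfin)⟩
  refine ⟨Ψ (hmem.toLp u'), ?_, ?_⟩
  · rw [hΨ, ← duhamel_delay F (fun s => B (u s)) ht]
    unfold duhamel
    rw [intervalIntegral.integral_of_le hT, intervalIntegral.integral_of_le hT]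
    refine integral_congr_ae ?_
    filter_upwards [hmem.coeFn_toLp] with s hs
    rw [hs, hu']
    by_cases hs : s ∈ Ioi (T - t)
    · simp only [indicator_of_mem hs]
    · simp only [indicator_of_notMem hs, _root_.map_zero]
  · have h1 : ‖hmem.toLp u'‖ ≤ t ^ p.toReal⁻¹ * c := by
      rw [Lp.norm_toLp]
      refine ENNReal.toReal_le_of_le_ofReal (by have := ht.1; positivity) (hnorm.trans_eq ?_)
      rw [ENNReal.ofReal_mul (Real.rpow_nonneg ht.1 _), ENNReal.ofReal_rpow_of_nonneg ht.1 hq.le]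
    calc ‖Ψ (hmem.toLp u')‖ ≤ ‖Ψ‖ * ‖hmem.toLp u'‖ := Ψ.le_opNorm _
      _ ≤ ‖Ψ‖ * (t ^ p.toReal⁻¹ * c) := by gcongr
      _ = _ := by ring

end Admissible

/-! ### The perturbed equation on the interval `[0, T]` -/

section LocalSolution

variable {𝕜 X E : Type*} [RCLike 𝕜] [NormedAddCommGroup X] [InnerProductSpace 𝕜 X]
  [NormedAddCommGroup E] [InnerProductSpace 𝕜 E] [NormedSpace ℝ E]

/-- A contraction semigroup `S` on `X`, a contraction semigroup `F` on `E` extending it along the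
injection `ι : X → E`, and an operator `B : X → E` whose Duhamel integrals over `[0, T]` take
values in `X`, with the bound `M tᵠ sup ‖u‖`. -/
structure IsPerturbation (ι : X →L[𝕜] E) (S : ℝ → X →L[𝕜] X) (F : ℝ → E →L[𝕜] E)
    (B : X →L[𝕜] E) (T M q : ℝ) : Prop where
  semigroup : IsC0Semigroup S
  contraction : ∀ t : ℝ, 0 ≤ t → ‖S t‖ ≤ 1
  extension : IsContractionSemigroup F
  injective : Function.Injective ι
  intertwine : ∀ t : ℝ, 0 ≤ t → ∀ x, F t (ι x) = ι (S t x)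
  time_pos : 0 < T
  bound_nonneg : 0 ≤ M
  exponent_pos : 0 < q
  bound : DuhamelBound ι F B T M q

/-- `x` is a mild solution on `[0, a]` of `x' = (A₋₁ - ρ B) x`, `x(0) = x₀`. -/
def IsMildOn (ι : X →L[𝕜] E) (S : ℝ → X →L[𝕜] X) (F : ℝ → E →L[𝕜] E) (B : X →L[𝕜] E)
    (ρ a : ℝ) (x₀ : X) (x : ℝ → X) : Prop :=
  ContinuousOn x (Icc 0 a) ∧
    ∀ t ∈ Icc 0 a, ι (x t) = ι (S t x₀) - ρ • duhamel F (fun s => B (x s)) t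

namespace IsPerturbation

variable {ι : X →L[𝕜] E} {S : ℝ → X →L[𝕜] X} {F : ℝ → E →L[𝕜] E} {B : X →L[𝕜] E} {T M q : ℝ}

theorem norm_semigroup_le (H : IsPerturbation ι S F B T M q) {t : ℝ} (ht : 0 ≤ t) (x : X) :
    ‖S t x‖ ≤ ‖x‖ :=
  ((S t).le_of_opNorm_le (H.contraction t ht) x).trans_eq (one_mul _)

/-- The bound of `DuhamelBound` for inputs that are continuous only on `[0, t]`. -/
theorem norm_le (H : IsPerturbation ι S F B T M q) {u : ℝ → X} {t c : ℝ} (ht : t ∈ Icc 0 T)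
    (hu : ContinuousOn u (Icc 0 t)) (hc : 0 ≤ c) (hb : ∀ s ∈ Icc 0 t, ‖u s‖ ≤ c) {v : X}
    (hv : ι v = duhamel F (fun s => B (u s)) t) : ‖v‖ ≤ M * t ^ q * c := by
  have hcl : ∀ s, max 0 (min s t) ∈ Icc 0 t := fun s =>
    ⟨le_max_left _ _, max_le ht.1 (min_le_right _ _)⟩
  have hcl' : ∀ s ∈ Icc 0 t, max 0 (min s t) = s := fun s hs => by
    rw [min_eq_left hs.2, max_eq_right hs.1]
  obtain ⟨w, hw, hw'⟩ := H.bound (fun s => u (max 0 (min s t)))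
    (hu.comp_continuous (continuous_const.max (continuous_id.min continuous_const)) hcl)
    t ht c hc (fun s _ => hb _ (hcl s))
  rw [duhamel_congr F ht.1 (g := fun s => B (u s)) fun s hs => by simp only [hcl' s hs],
    ← hv] at hw
  rwa [H.injective hw] at hw'

/-- Preimages under `ι` of a Duhamel integral of `B u` are continuous in time, because
`Φ_{h+s} u - Φ_s u = S(s) Φ_h u + Φ_s (u(h + ·) - u)`, where `Φ_t u` is the preimage at time `t`. -/
theorem continuousOn_preimage [CompleteSpace E] (H : IsPerturbation ι S F B T M q) {u D : ℝ → X}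
    (hu : Continuous u) (hD : ∀ t ∈ Icc 0 T, ι (D t) = duhamel F (fun s => B (u s)) t) :
    ContinuousOn D (Icc 0 T) := by
  have hM := H.bound_nonneg
  have hT := H.time_pos
  have hTq : 0 ≤ T ^ q := Real.rpow_nonneg hT.le q
  obtain ⟨c, hc⟩ := isCompact_Icc.exists_bound_of_continuousOn (s := Icc 0 T) hu.continuousOn
  have hc0 : 0 ≤ c := (norm_nonneg _).trans (hc 0 ⟨le_rfl, hT.le⟩)
  have key : ∀ ε > 0, ∃ η > 0, ∀ s h, 0 ≤ s → 0 ≤ h → h + s ≤ T → h < η →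
      ‖D (h + s) - D s‖ < ε := by
    intro ε hε
    set c' := ε / (2 * (M * T ^ q + 1)) with hc'
    have hc'0 : 0 < c' := by positivity
    obtain ⟨η₁, hη₁, hu₁⟩ := Metric.uniformContinuousOn_iff.1
      (isCompact_Icc.uniformContinuousOn_of_continuous hu.continuousOn (s := Icc 0 T)) c' hc'0
    have hpow : ContinuousAt (fun h : ℝ => M * h ^ q * c) 0 :=
      ((Real.continuousAt_rpow_const 0 q (Or.inr H.exponent_pos.le)).const_mul M).mul_const c
    obtain ⟨η₂, hη₂, hu₂⟩ := Metric.continuousAt_iff.1 hpow (ε / 2) (half_pos hε)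
    refine ⟨min η₁ η₂, lt_min hη₁ hη₂, fun s h hs hh hhs hlt => ?_⟩
    have hsT : s ∈ Icc 0 T := ⟨hs, by linarith⟩
    have hhT : h ∈ Icc 0 T := ⟨hh, by linarith⟩
    have e1 : ι (D (h + s) - D s - S s (D h)) =
        duhamel F (fun r => B (u (h + r) - u r)) s := by
      have hB : Continuous fun r => B (u r) := B.continuous.comp hu
      rw [_root_.map_sub, _root_.map_sub, hD _ ⟨by linarith, hhs⟩, hD s hsT,
        ← H.intertwine s hs, hD h hhT, H.extension.duhamel_add hh hs hB.continuousOn]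
      simp only [_root_.map_sub]
      rw [H.extension.duhamel_sub (f := fun r => B (u (h + r))) hs
        (hB.comp (continuous_const.add continuous_id)).continuousOn hB.continuousOn]
      abel
    have hb : ∀ r ∈ Icc 0 s, ‖u (h + r) - u r‖ ≤ c' := fun r hr => by
      have := hu₁ (h + r) ⟨by linarith [hr.1], by linarith [hr.2]⟩ r
        ⟨hr.1, by linarith [hr.2]⟩ (by
          rw [Real.dist_eq, add_sub_cancel_right, abs_of_nonneg hh]
          exact hlt.trans_le (min_le_left _ _))
      rw [dist_eq_norm] at this
      exact this.le
    have h1 : ‖D (h + s) - D s - S s (D h)‖ ≤ M * s ^ q * c' :=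
      H.norm_le hsT
        ((hu.comp (continuous_const.add continuous_id)).sub hu).continuousOn hc'0.le hb e1
    have h2 : ‖S s (D h)‖ < ε / 2 := by
      refine (H.norm_semigroup_le hs _).trans_lt ?_
      refine (H.norm_le hhT hu.continuousOn hc0
        (fun r hr => hc r ⟨hr.1, hr.2.trans hhT.2⟩) (hD h hhT)).trans_lt ?_
      have := @hu₂ h (by
        rw [Real.dist_eq, sub_zero, abs_of_nonneg hh]
        exact hlt.trans_le (min_le_right _ _))
      rw [Real.dist_eq, Real.zero_rpow H.exponent_pos.ne', mul_zero, zero_mul, sub_zero] at this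
      exact (le_abs_self _).trans_lt this
    have h3 : M * s ^ q * c' ≤ ε / 2 := by
      have : s ^ q ≤ T ^ q := Real.rpow_le_rpow hs hsT.2 H.exponent_pos.le
      calc M * s ^ q * c' ≤ (M * T ^ q + 1) * c' := by
            gcongr
            nlinarith
        _ = ε / 2 := by rw [hc']; field_simp
    calc ‖D (h + s) - D s‖ = ‖(D (h + s) - D s - S s (D h)) + S s (D h)‖ := by
          rw [sub_add_cancel]
      _ ≤ _ := norm_add_le _ _
      _ < ε := by linarith
  rw [Metric.continuousOn_iff]
  intro t ht ε hε
  obtain ⟨η, hη, hk⟩ := key ε hε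
  refine ⟨η, hη, fun s hs hst => ?_⟩
  rw [Real.dist_eq] at hst
  rcases le_total s t with h | h
  · rw [dist_comm, dist_eq_norm]
    have := hk s (t - s) hs.1 (by linarith) (by linarith [ht.2])
      (by rw [abs_sub_comm, abs_of_nonneg (by linarith)] at hst; exact hst)
    rwa [sub_add_cancel] at this
  · rw [dist_eq_norm]
    have := hk t (s - t) ht.1 (by linarith) (by linarith [hs.2])
      (by rw [abs_of_nonneg (by linarith)] at hst; exact hst)
    rwa [sub_add_cancel] at this

variable [IsScalarTower ℝ 𝕜 E]

/-- The right-hand side of the mild equation is Lipschitz in the solution, with constant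
`ρ M T^q`. -/
theorem norm_sub_le (H : IsPerturbation ι S F B T M q) {ρ : ℝ} (hρ : 0 ≤ ρ) {u w : ℝ → X} {t c : ℝ}
    (ht : t ∈ Icc 0 T) (hu : ContinuousOn u (Icc 0 t)) (hw : ContinuousOn w (Icc 0 t))
    (hc : 0 ≤ c) (hb : ∀ s ∈ Icc 0 t, ‖u s - w s‖ ≤ c) {a : E} {x y : X}
    (hx : ι x = a - ρ • duhamel F (fun s => B (u s)) t)
    (hy : ι y = a - ρ • duhamel F (fun s => B (w s)) t) :
    ‖x - y‖ ≤ ρ * (M * T ^ q) * c := by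
  have hM := H.bound_nonneg
  have e : ι (x - y) = duhamel F (fun s => B ((((-ρ : ℝ) : 𝕜)) • (u s - w s))) t := by
    simp only [map_smul, ← RCLike.real_smul_eq_coe_smul (K := 𝕜), _root_.map_sub]
    rw [duhamel_smul, H.extension.duhamel_sub (f := fun s => B (u s)) (g := fun s => B (w s)) ht.1
      (B.continuous.comp_continuousOn hu)
      (B.continuous.comp_continuousOn hw), hx, hy, neg_smul, smul_sub]
    abel
  have h1 := H.norm_le (u := fun s => ((-ρ : ℝ) : 𝕜) • (u s - w s)) ht ((hu.sub hw).const_smul _) (mul_nonneg hρ hc)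
    (fun s hs => by
      rw [norm_smul, RCLike.norm_ofReal, abs_neg, abs_of_nonneg hρ]
      exact mul_le_mul_of_nonneg_left (hb s hs) hρ) e
  have : t ^ q ≤ T ^ q := Real.rpow_le_rpow ht.1 ht.2 H.exponent_pos.le
  calc ‖x - y‖ ≤ M * t ^ q * (ρ * c) := h1
    _ ≤ M * T ^ q * (ρ * c) := by gcongr
    _ = _ := by ring

/-- Banach's fixed point theorem in `C([0, T], X)`. -/
theorem exists_isMildOn [CompleteSpace X] [CompleteSpace E] (H : IsPerturbation ι S F B T M q)
    {ρ : ℝ} (hρ : 0 ≤ ρ) (hsmall : ρ * (M * T ^ q) ≤ 1 / 2) (x₀ : X) :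
    ∃ x, IsMildOn ι S F B ρ T x₀ x := by
  have hT := H.time_pos
  -- Functions on `[0, T]` are extended to `ℝ` by their end values.
  let ext : C(Icc 0 T, X) → ℝ → X := fun u s => u (projIcc 0 T hT.le s)
  have hext : ∀ u, Continuous (ext u) := fun u => u.continuous.comp continuous_projIcc
  have hex : ∀ u : C(Icc 0 T, X), ∃ g : C(Icc 0 T, X), ∀ t : Icc 0 T,
      ι (g t) = ι (S t x₀) - ρ • duhamel F (fun s => B (ext u s)) t := by
    intro u
    have h1 : ∀ t : ℝ, ∃ v : X, t ∈ Icc 0 T → ι v = duhamel F (fun s => B (ext u s)) t := by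
      intro t
      by_cases ht : t ∈ Icc 0 T
      · obtain ⟨v, hv, -⟩ := H.bound (ext u) (hext u) t ht ‖u‖ (norm_nonneg _)
          (fun s _ => u.norm_coe_le_norm _)
        exact ⟨v, fun _ => hv⟩
      · exact ⟨0, fun h => absurd h ht⟩
    choose D hD using h1
    have hDc := H.continuousOn_preimage (hext u) hD
    have hSc : ContinuousOn (fun t => S t x₀) (Icc 0 T) :=
      (H.semigroup.continuousOn x₀).mono Icc_subset_Ici_self
    refine ⟨⟨fun t => S t x₀ - (ρ : 𝕜) • D t,
      (hSc.domRestrict.sub (hDc.domRestrict.const_smul (ρ : 𝕜)))⟩, fun t => ?_⟩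
    change ι (S t x₀ - (ρ : 𝕜) • D t) = _
    rw [_root_.map_sub, map_smul, hD t t.2, ← RCLike.real_smul_eq_coe_smul (K := 𝕜)]
  choose G hG using hex
  have hcontr : ContractingWith (1 / 2 : NNReal) G := by
    refine ⟨by rw [← NNReal.coe_lt_coe]; norm_num, LipschitzWith.of_dist_le_mul fun u w => ?_⟩
    rw [ContinuousMap.dist_le (by positivity)]
    intro t
    rw [dist_eq_norm]
    refine (H.norm_sub_le hρ t.2 (hext u).continuousOn (hext w).continuousOn
      (dist_nonneg (x := u) (y := w)) (fun s _ => ?_) (hG u t) (hG w t)).trans ?_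
    · rw [← dist_eq_norm]
      exact ContinuousMap.dist_apply_le_dist _
    · refine mul_le_mul_of_nonneg_right (hsmall.trans_eq ?_) dist_nonneg
      simp
  obtain ⟨u, hu, -⟩ := hcontr.exists_fixedPoint 0 (edist_ne_top _ _)
  refine ⟨ext u, (hext u).continuousOn, fun t ht => ?_⟩
  have h1 := hG u ⟨t, ht⟩
  rw [hu] at h1
  have h2 : ext u t = u ⟨t, ht⟩ := by
    change u (projIcc 0 T hT.le t) = _
    rw [projIcc_of_mem hT.le ht]
  rw [h2, h1]

theorem eqOn_of_isMildOn (H : IsPerturbation ι S F B T M q)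
    {ρ : ℝ} (hρ : 0 ≤ ρ) (hsmall : ρ * (M * T ^ q) ≤ 1 / 2) {x₀ : X} {x y : ℝ → X}
    (hx : IsMildOn ι S F B ρ T x₀ x) (hy : IsMildOn ι S F B ρ T x₀ y) : EqOn x y (Icc 0 T) := by
  have hT := H.time_pos
  obtain ⟨τ, hτ, hmax⟩ := isCompact_Icc.exists_isMaxOn (nonempty_Icc.2 hT.le)
    (hx.1.sub hy.1).norm
  have hle : ∀ s ∈ Icc 0 T, ‖x s - y s‖ ≤ ‖x τ - y τ‖ := fun s hs => hmax hs
  have hsub : Icc 0 τ ⊆ Icc 0 T := Icc_subset_Icc_right hτ.2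
  have h1 := H.norm_sub_le hρ hτ (hx.1.mono hsub) (hy.1.mono hsub) (norm_nonneg _)
    (fun s hs => hle s (hsub hs)) (hx.2 τ hτ) (hy.2 τ hτ)
  have h2 : ‖x τ - y τ‖ ≤ 0 := by
    nlinarith [norm_nonneg (x τ - y τ)]
  intro t ht
  exact sub_eq_zero.1 (norm_le_zero_iff.1 ((hle t ht).trans h2))

theorem norm_sub_semigroup_le_of_bound (H : IsPerturbation ι S F B T M q)
    {ρ : ℝ} (hρ : 0 ≤ ρ) {x₀ : X} {x : ℝ → X} (hx : IsMildOn ι S F B ρ T x₀ x) {c : ℝ} (hc : 0 ≤ c)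
    (hb : ∀ s ∈ Icc 0 T, ‖x s‖ ≤ c) {t : ℝ} (ht : t ∈ Icc 0 T) :
    ‖x t - S t x₀‖ ≤ ρ * (M * T ^ q) * c := by
  have hsub : Icc 0 t ⊆ Icc 0 T := Icc_subset_Icc_right ht.2
  refine H.norm_sub_le hρ ht (hx.1.mono hsub) (w := fun _ => 0) continuousOn_const hc
    (fun s hs => ?_) (hx.2 t ht) ?_
  · rw [sub_zero]; exact hb s (hsub hs)
  · simp [duhamel]

theorem norm_le_of_isMildOn (H : IsPerturbation ι S F B T M q)
    {ρ : ℝ} (hρ : 0 ≤ ρ) (hsmall : ρ * (M * T ^ q) ≤ 1 / 2) {x₀ : X} {x : ℝ → X}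
    (hx : IsMildOn ι S F B ρ T x₀ x) {t : ℝ} (ht : t ∈ Icc 0 T) : ‖x t‖ ≤ 2 * ‖x₀‖ := by
  have hT := H.time_pos
  obtain ⟨τ, hτ, hmax⟩ := isCompact_Icc.exists_isMaxOn (nonempty_Icc.2 hT.le) hx.1.norm
  have hle : ∀ s ∈ Icc 0 T, ‖x s‖ ≤ ‖x τ‖ := fun s hs => hmax hs
  have h1 := H.norm_sub_semigroup_le_of_bound hρ hx (norm_nonneg _) hle hτ
  have h2 := H.norm_semigroup_le hτ.1 x₀
  have h3 : ‖x τ‖ ≤ ‖x τ - S τ x₀‖ + ‖S τ x₀‖ := by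
    simpa using norm_add_le (x τ - S τ x₀) (S τ x₀)
  have h4 := hle t ht
  nlinarith [norm_nonneg (x τ)]

theorem norm_sub_semigroup_le (H : IsPerturbation ι S F B T M q)
    {ρ : ℝ} (hρ : 0 ≤ ρ) (hsmall : ρ * (M * T ^ q) ≤ 1 / 2) {x₀ : X} {x : ℝ → X}
    (hx : IsMildOn ι S F B ρ T x₀ x) {t : ℝ} (ht : t ∈ Icc 0 T) :
    ‖x t - S t x₀‖ ≤ ρ * (M * T ^ q) * (2 * ‖x₀‖) :=
  H.norm_sub_semigroup_le_of_bound hρ hx (by positivity)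
    (fun _ hs => H.norm_le_of_isMildOn hρ hsmall hx hs) ht

end IsPerturbation

end LocalSolution

/-! ### Concatenation of mild solutions and global well-posedness -/

section Global

variable {𝕜 X E : Type*} [RCLike 𝕜] [NormedAddCommGroup X] [InnerProductSpace 𝕜 X]
  [NormedAddCommGroup E] [InnerProductSpace 𝕜 E] [NormedSpace ℝ E]
  {ι : X →L[𝕜] E} {S : ℝ → X →L[𝕜] X} {F : ℝ → E →L[𝕜] E} {B : X →L[𝕜] E} {T M q ρ : ℝ}

theorem IsMildOn.mono {a b : ℝ} {x₀ : X} {x : ℝ → X} (hx : IsMildOn ι S F B ρ b x₀ x)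
    (hab : a ≤ b) : IsMildOn ι S F B ρ a x₀ x :=
  ⟨hx.1.mono (Icc_subset_Icc_right hab), fun t ht => hx.2 t ⟨ht.1, ht.2.trans hab⟩⟩

theorem IsMildOn.congr {a : ℝ} {x₀ : X} {x y : ℝ → X} (hx : IsMildOn ι S F B ρ a x₀ x)
    (h : EqOn y x (Icc 0 a)) : IsMildOn ι S F B ρ a x₀ y := by
  refine ⟨hx.1.congr h, fun t ht => ?_⟩
  rw [h ht, hx.2 t ht, duhamel_congr F ht.1 (f := fun s => B (y s)) (g := fun s => B (x s))
    fun s hs => by simp only [h ⟨hs.1, hs.2.trans ht.2⟩]]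

namespace IsPerturbation

theorem apply_zero_of_isMildOn (H : IsPerturbation ι S F B T M q) {a : ℝ} (ha : 0 ≤ a) {x₀ : X}
    {x : ℝ → X} (hx : IsMildOn ι S F B ρ a x₀ x) : x 0 = x₀ := by
  refine H.injective ?_
  rw [hx.2 0 ⟨le_rfl, ha⟩, duhamel_zero, smul_zero, sub_zero, H.semigroup.map_zero,
    ContinuousLinearMap.id_apply]

variable [CompleteSpace E] [IsScalarTower ℝ 𝕜 E]

/-- The right-hand side of the mild equation at time `a + s` is the one at time `s` of the equation
restarted from `x a`. -/
theorem restart (H : IsPerturbation ι S F B T M q) {a s : ℝ} (ha : 0 ≤ a) (hs : 0 ≤ s) {x₀ : X}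
    {x : ℝ → X} (hx : ContinuousOn x (Icc 0 (a + s)))
    (hxa : ι (x a) = ι (S a x₀) - ρ • duhamel F (fun r => B (x r)) a) :
    ι (S (a + s) x₀) - ρ • duhamel F (fun r => B (x r)) (a + s) =
      ι (S s (x a)) - ρ • duhamel F (fun r => B (x (a + r))) s := by
  have hBx : ContinuousOn (fun r => B (x r)) (Icc 0 (a + s)) := B.continuous.comp_continuousOn hx
  rw [H.extension.duhamel_add ha hs hBx, ← H.intertwine s hs,
    hxa, ← H.intertwine _ (add_nonneg ha hs), ← H.intertwine a ha, add_comm a s,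
    H.extension.map_add s a hs ha, _root_.map_sub, RCLike.real_smul_eq_coe_smul (K := 𝕜) ρ,
    RCLike.real_smul_eq_coe_smul (K := 𝕜) ρ, map_smul, RCLike.real_smul_eq_coe_smul (K := 𝕜) ρ,
    smul_add]
  abel

theorem isMildOn_shift (H : IsPerturbation ι S F B T M q) {a b : ℝ} (ha : 0 ≤ a) {x₀ : X}
    {x : ℝ → X} (hx : IsMildOn ι S F B ρ (a + b) x₀ x) :
    IsMildOn ι S F B ρ b (x a) (fun s => x (a + s)) := by
  refine ⟨hx.1.comp (continuousOn_const.add continuousOn_id) fun s hs =>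
    ⟨add_nonneg ha hs.1, by simpa using hs.2⟩, fun s hs => ?_⟩
  have hs2 : a + s ≤ a + b := by linarith [hs.2]
  rw [hx.2 (a + s) ⟨add_nonneg ha hs.1, hs2⟩]
  exact H.restart ha hs.1 (hx.1.mono (Icc_subset_Icc_right hs2))
    (hx.2 a ⟨ha, by linarith [hs.1]⟩)

theorem isMildOn_concat (H : IsPerturbation ι S F B T M q) {a b : ℝ} (ha : 0 ≤ a) (hb : 0 ≤ b)
    {x₀ : X} {x y : ℝ → X} (hx : IsMildOn ι S F B ρ a x₀ x) (hy : IsMildOn ι S F B ρ b (x a) y) :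
    IsMildOn ι S F B ρ (a + b) x₀ (fun t => if t ≤ a then x t else y (t - a)) := by
  set z : ℝ → X := fun t => if t ≤ a then x t else y (t - a) with hz
  have hzx : EqOn z x (Icc 0 a) := fun t ht => if_pos ht.2
  have hzy : EqOn z (fun t => y (t - a)) (Icc a (a + b)) := by
    intro t ht
    rcases ht.1.eq_or_lt with h | h
    · simp only [hz, ← h, le_refl, if_true, sub_self]
      exact (H.apply_zero_of_isMildOn hb hy).symm
    · exact if_neg (not_le.2 h)
  have hzc : ContinuousOn z (Icc 0 (a + b)) := by
    rw [← Icc_union_Icc_eq_Icc ha (by linarith : a ≤ a + b)]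
    refine ContinuousOn.union_of_isClosed (hx.1.congr hzx) (ContinuousOn.congr ?_ hzy)
      isClosed_Icc isClosed_Icc
    exact hy.1.comp (continuousOn_id.sub continuousOn_const) fun t ht =>
      ⟨sub_nonneg.2 ht.1, by simpa [add_comm] using ht.2⟩
  have hza := hx.congr hzx
  refine ⟨hzc, fun t ht => ?_⟩
  rcases le_total t a with h | h
  · exact hza.2 t ⟨ht.1, h⟩
  · obtain ⟨s, rfl⟩ : ∃ s, t = a + s := ⟨t - a, by ring⟩
    have hs : 0 ≤ s := by linarith
    have hsb : s ≤ b := by linarith [ht.2]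
    rw [H.restart ha hs (hzc.mono (Icc_subset_Icc_right ht.2)) (hza.2 a ⟨ha, le_rfl⟩),
      hzy ⟨h, ht.2⟩, hzx ⟨ha, le_rfl⟩]
    simp only [add_sub_cancel_left]
    rw [hy.2 s ⟨hs, hsb⟩, duhamel_congr F hs (f := fun r => B (z (a + r))) (g := fun r => B (y r))
      fun r hr => by
        simp only [hzy (x := a + r) ⟨by linarith [hr.1], by linarith [hr.2]⟩, add_sub_cancel_left]]

theorem exists_isMildOn_nat [CompleteSpace X] (H : IsPerturbation ι S F B T M q) (hρ : 0 ≤ ρ)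
    (hsmall : ρ * (M * T ^ q) ≤ 1 / 2) (n : ℕ) (x₀ : X) :
    ∃ x, IsMildOn ι S F B ρ (n * T) x₀ x := by
  have hT := H.time_pos
  induction n generalizing x₀ with
  | zero =>
    obtain ⟨x, hx⟩ := H.exists_isMildOn hρ hsmall x₀
    exact ⟨x, hx.mono (by simpa using hT.le)⟩
  | succ n ih =>
    obtain ⟨x, hx⟩ := H.exists_isMildOn hρ hsmall x₀
    obtain ⟨y, hy⟩ := ih (x T)
    have := H.isMildOn_concat hT.le (by positivity) hx hy
    rw [show T + n * T = (n + 1 : ℕ) * T by push_cast; ring] at this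
    exact ⟨_, this⟩

theorem eqOn_of_isMildOn_nat (H : IsPerturbation ι S F B T M q) (hρ : 0 ≤ ρ)
    (hsmall : ρ * (M * T ^ q) ≤ 1 / 2) (n : ℕ) {x₀ : X} {x y : ℝ → X}
    (hx : IsMildOn ι S F B ρ (n * T) x₀ x) (hy : IsMildOn ι S F B ρ (n * T) x₀ y) :
    EqOn x y (Icc 0 (n * T)) := by
  have hT := H.time_pos
  induction n generalizing x₀ x y with
  | zero =>
    intro t ht
    have : t = 0 := le_antisymm (by simpa using ht.2) ht.1
    rw [this, H.apply_zero_of_isMildOn (by simp) hx, H.apply_zero_of_isMildOn (by simp) hy]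
  | succ n ih =>
    have e : ((n + 1 : ℕ) : ℝ) * T = T + n * T := by push_cast; ring
    rw [e] at hx hy ⊢
    have hn : T ≤ T + n * T := by
      have : 0 ≤ n * T := by positivity
      linarith
    have h1 := H.eqOn_of_isMildOn hρ hsmall (hx.mono hn) (hy.mono hn)
    have hy' := H.isMildOn_shift hT.le hy
    rw [← h1 ⟨hT.le, le_rfl⟩] at hy'
    have h2 := ih (H.isMildOn_shift hT.le hx) hy'
    intro t ht
    rcases le_total t T with h | h
    · exact h1 ⟨ht.1, h⟩
    · have := h2 (x := t - T) ⟨by linarith, by linarith [ht.2]⟩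
      simpa using this

/-- Solutions on `[0, n T]` agree on common intervals by uniqueness, so they define a global one. -/
theorem exists_isMildOn_forall [CompleteSpace X] (H : IsPerturbation ι S F B T M q) (hρ : 0 ≤ ρ)
    (hsmall : ρ * (M * T ^ q) ≤ 1 / 2) (x₀ : X) :
    ∃ x, ∀ a, IsMildOn ι S F B ρ a x₀ x := by
  have hT := H.time_pos
  choose Y hY using fun n => H.exists_isMildOn_nat hρ hsmall n x₀
  refine ⟨fun t => Y ⌈t / T⌉₊ t, fun a => ?_⟩
  have ha : a ≤ ⌈a / T⌉₊ * T := (div_le_iff₀ hT).1 (Nat.le_ceil _)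
  refine IsMildOn.mono ((hY ⌈a / T⌉₊).congr fun t ht => ?_) ha
  have h1 : ⌈t / T⌉₊ ≤ ⌈a / T⌉₊ := Nat.ceil_le.2 ((div_le_iff₀ hT).2 ht.2)
  have h2 : (⌈t / T⌉₊ : ℝ) * T ≤ ⌈a / T⌉₊ * T := by gcongr
  exact H.eqOn_of_isMildOn_nat hρ hsmall _ (hY ⌈t / T⌉₊) ((hY ⌈a / T⌉₊).mono h2)
    ⟨ht.1, (div_le_iff₀ hT).1 (Nat.le_ceil _)⟩

theorem eqOn_of_isMildOn_forall (H : IsPerturbation ι S F B T M q) (hρ : 0 ≤ ρ)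
    (hsmall : ρ * (M * T ^ q) ≤ 1 / 2) {x₀ : X} {x y : ℝ → X}
    (hx : ∀ a, IsMildOn ι S F B ρ a x₀ x) (hy : ∀ a, IsMildOn ι S F B ρ a x₀ y) :
    EqOn x y (Ici 0) := fun t ht =>
  H.eqOn_of_isMildOn_nat hρ hsmall ⌈t / T⌉₊ (hx _) (hy _)
    ⟨ht, (div_le_iff₀ H.time_pos).1 (Nat.le_ceil _)⟩

end IsPerturbation

end Global

/-! ### Energy decay -/

section Decay

variable {𝕜 X E : Type*} [RCLike 𝕜] [NormedAddCommGroup X] [InnerProductSpace 𝕜 X]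
  [NormedAddCommGroup E] [InnerProductSpace 𝕜 E]

theorem re_inner_sub_le (B ι : X →L[𝕜] E) (a b : X) :
    RCLike.re (inner 𝕜 (B b) (ι b)) - RCLike.re (inner 𝕜 (B a) (ι a)) ≤
      ‖B‖ * ‖ι‖ * ‖a - b‖ * (‖a‖ + ‖b‖) := by
  have e : RCLike.re (inner 𝕜 (B b) (ι b)) - RCLike.re (inner 𝕜 (B a) (ι a)) =
      RCLike.re (inner 𝕜 (B (b - a)) (ι b)) + RCLike.re (inner 𝕜 (B a) (ι (b - a))) := by
    simp only [map_sub, inner_sub_left, inner_sub_right]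
    ring
  have h : ∀ c d : X, RCLike.re (inner 𝕜 (B c) (ι d)) ≤ ‖B‖ * ‖ι‖ * ‖c‖ * ‖d‖ := fun c d =>
    calc RCLike.re (inner 𝕜 (B c) (ι d)) ≤ ‖B c‖ * ‖ι d‖ := re_inner_le_norm _ _
      _ ≤ (‖B‖ * ‖c‖) * (‖ι‖ * ‖d‖) := by
          gcongr
          · exact B.le_opNorm c
          · exact ι.le_opNorm d
      _ = _ := by ring
  have h1 := h (b - a) b
  have h2 := h a (b - a)
  rw [norm_sub_rev] at h1 h2
  rw [e]
  linarith

variable [NormedSpace ℝ E] {ι : X →L[𝕜] E} {S : ℝ → X →L[𝕜] X} {F : ℝ → E →L[𝕜] E}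
  {B : X →L[𝕜] E} {T M q ρ : ℝ}

namespace IsPerturbation

variable [CompleteSpace E] [IsScalarTower ℝ 𝕜 E]

/-- One period of the closed-loop system decreases the `E`-energy by `δ ρ ‖x(T)‖²`, up to an error
of order `ρ²`. -/
theorem energy_le (H : IsPerturbation ι S F B T M q) (hρ : 0 ≤ ρ)
    (hsmall : ρ * (M * T ^ q) ≤ 1 / 2) {δ : ℝ} (hδ : 0 ≤ δ)
    (hobs : ∀ x : X, δ * ‖S T x‖ ^ 2 ≤
      ∫ t in (0 : ℝ)..T, RCLike.re (inner 𝕜 (B (S t x)) (ι (S t x))))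
    {x₀ : X} {x : ℝ → X} (hx : IsMildOn ι S F B ρ T x₀ x) :
    ‖ι (x T)‖ ^ 2 + δ * ρ * ‖x T‖ ^ 2 ≤ ‖ι x₀‖ ^ 2 +
      (12 * T * ‖B‖ * ‖ι‖ * (M * T ^ q) + 4 * δ * (M * T ^ q) + 1) * ρ ^ 2 * ‖x₀‖ ^ 2 := by
  have hT := H.time_pos
  have hM := H.bound_nonneg
  set N := M * T ^ q with hN
  have hN0 : 0 ≤ N := by positivity
  have hTT : T ∈ Icc 0 T := ⟨hT.le, le_rfl⟩
  -- The energy inequality wants functions that are continuous on all of `ℝ`.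
  set y : ℝ → X := fun s => x (max 0 (min s T)) with hy
  have hcl : ∀ s, max 0 (min s T) ∈ Icc 0 T := fun s =>
    ⟨le_max_left _ _, max_le hT.le (min_le_right _ _)⟩
  have hyx : EqOn y x (Icc 0 T) := fun s hs => by
    simp only [hy, min_eq_left hs.2, max_eq_right hs.1]
  have hyc : Continuous y :=
    hx.1.comp_continuous (continuous_const.max (continuous_id.min continuous_const)) hcl
  have hym : IsMildOn ι S F B ρ T x₀ y := hx.congr hyx
  have hfc : Continuous fun s => (-ρ) • B (y s) := by
    simp only [RCLike.real_smul_eq_coe_smul (K := 𝕜) (-ρ)]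
    exact (B.continuous.comp hyc).const_smul _
  have hen := H.extension.norm_sq_le (𝕜 := 𝕜) hfc (ι x₀) (w := fun s => ι (y s))
    (ι.continuous.comp hyc) hT.le (fun t ht => by
      rw [hym.2 t ht, duhamel_smul, H.intertwine t ht.1, neg_smul, sub_eq_add_neg])
  set P : ℝ → ℝ := fun t => RCLike.re (inner 𝕜 (B (S t x₀)) (ι (S t x₀))) with hP
  have hSc : ContinuousOn (fun t => S t x₀) (Icc 0 T) :=
    (H.semigroup.continuousOn x₀).mono Icc_subset_Ici_self
  have hPc : ContinuousOn P (Icc 0 T) :=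
    RCLike.continuous_re.comp_continuousOn
      ((B.continuous.comp_continuousOn hSc).inner (ι.continuous.comp_continuousOn hSc))
  have hPi : IntervalIntegrable P volume 0 T :=
    ContinuousOn.intervalIntegrable (by rwa [uIcc_of_le hT.le])
  set ε := 6 * ‖B‖ * ‖ι‖ * N * ρ * ‖x₀‖ ^ 2 with hε
  have hpt : ∀ t ∈ Icc 0 T,
      2 * RCLike.re (inner 𝕜 (ι (y t)) ((-ρ) • B (y t))) ≤ (-2 * ρ) * (P t - ε) := by
    intro t ht
    rw [RCLike.real_smul_eq_coe_smul (K := 𝕜) (-ρ), inner_smul_right, RCLike.re_ofReal_mul,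
      inner_re_symm]
    have h1 := re_inner_sub_le B ι (y t) (S t x₀)
    have h2 : ‖y t - S t x₀‖ ≤ ρ * N * (2 * ‖x₀‖) := H.norm_sub_semigroup_le hρ hsmall hym ht
    have h3 : ‖y t‖ ≤ 2 * ‖x₀‖ := H.norm_le_of_isMildOn hρ hsmall hym ht
    have h4 : ‖S t x₀‖ ≤ ‖x₀‖ := H.norm_semigroup_le ht.1 x₀
    have h5 : ‖B‖ * ‖ι‖ * ‖y t - S t x₀‖ * (‖y t‖ + ‖S t x₀‖) ≤ ε := by
      calc ‖B‖ * ‖ι‖ * ‖y t - S t x₀‖ * (‖y t‖ + ‖S t x₀‖)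
          ≤ ‖B‖ * ‖ι‖ * (ρ * N * (2 * ‖x₀‖)) * (2 * ‖x₀‖ + ‖x₀‖) := by gcongr
        _ = ε := by rw [hε]; ring
    have h6 : P t - ε ≤ RCLike.re (inner 𝕜 (B (y t)) (ι (y t))) := by
      have := h1.trans h5
      simp only [hP]
      linarith
    nlinarith
  have hint : ∫ t in (0 : ℝ)..T, 2 * RCLike.re (inner 𝕜 (ι (y t)) ((-ρ) • B (y t))) ≤
      (-2 * ρ) * ((∫ t in (0 : ℝ)..T, P t) - T * ε) := by
    have h1 := intervalIntegral.integral_mono_on hT.le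
      (Continuous.intervalIntegrable (continuous_const.mul (RCLike.continuous_re.comp
        ((ι.continuous.comp hyc).inner (𝕜 := 𝕜) hfc))) 0 T)
      ((hPi.sub (intervalIntegrable_const (c := ε))).const_mul (-2 * ρ)) hpt
    refine h1.trans_eq ?_
    rw [intervalIntegral.integral_const_mul, intervalIntegral.integral_sub hPi
      intervalIntegrable_const, intervalIntegral.integral_const, smul_eq_mul, sub_zero]
  have hobs' := hobs x₀
  have hxT : ‖x T‖ ^ 2 ≤ 2 * ‖S T x₀‖ ^ 2 + 8 * ρ ^ 2 * N ^ 2 * ‖x₀‖ ^ 2 := by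
    have h2 : ‖x T - S T x₀‖ ≤ ρ * N * (2 * ‖x₀‖) := H.norm_sub_semigroup_le hρ hsmall hx hTT
    have h3 : ‖x T‖ ≤ ‖S T x₀‖ + ρ * N * (2 * ‖x₀‖) := by
      have := norm_add_le (x T - S T x₀) (S T x₀)
      rw [sub_add_cancel] at this
      linarith
    calc ‖x T‖ ^ 2 ≤ (‖S T x₀‖ + ρ * N * (2 * ‖x₀‖)) ^ 2 := by gcongr
      _ ≤ _ := by nlinarith [sq_nonneg (‖S T x₀‖ - ρ * N * (2 * ‖x₀‖))]
  have hyT : y T = x T := hyx hTT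
  simp only [hyT] at hen
  have hA : δ * ρ * ‖x T‖ ^ 2 ≤ δ * ρ * (2 * ‖S T x₀‖ ^ 2 + 8 * ρ ^ 2 * N ^ 2 * ‖x₀‖ ^ 2) := by
    gcongr
  have hB : 2 * ρ * (δ * ‖S T x₀‖ ^ 2) ≤ 2 * ρ * ∫ t in (0 : ℝ)..T, P t := by gcongr
  -- The cubic term of the error is absorbed into the quadratic one through `ρ N ≤ 1 / 2`.
  have hC : 8 * δ * ρ ^ 2 * N * ‖x₀‖ ^ 2 * (ρ * N) ≤ 8 * δ * ρ ^ 2 * N * ‖x₀‖ ^ 2 * (1 / 2) := by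
    gcongr
  have hD : 0 ≤ ρ ^ 2 * ‖x₀‖ ^ 2 := by positivity
  rw [hε] at hint
  nlinarith

/-- Uniform exponential decay of all mild solutions, for all small gains `ρ`. -/
theorem exists_decay [CompleteSpace X] (H : IsPerturbation ι S F B T M q) {δ : ℝ} (hδ : 0 < δ)
    (hobs : ∀ x : X, δ * ‖S T x‖ ^ 2 ≤
      ∫ t in (0 : ℝ)..T, RCLike.re (inner 𝕜 (B (S t x)) (ι (S t x)))) :
    ∃ ρ₁ : ℝ, 0 < ρ₁ ∧ ∃ C : ℝ, 0 < C ∧ ∀ ρ : ℝ, 0 < ρ → ρ < ρ₁ → ∃ σ : ℝ, 0 < σ ∧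
      σ = (1 / (2 * T)) * Real.log ((‖ι‖ ^ 2 + δ * ρ) / (‖ι‖ ^ 2 + C * ρ ^ 2)) ∧
      ∃ K : ℝ, 0 < K ∧ ∀ x₀ : X, ∃ x : ℝ → X, (∀ a, IsMildOn ι S F B ρ a x₀ x) ∧
        (∀ y : ℝ → X, (∀ a, IsMildOn ι S F B ρ a x₀ y) → EqOn y x (Ici 0)) ∧
        ∀ t : ℝ, 0 ≤ t → ‖x t‖ ≤ K * Real.exp (-σ * t) * ‖x₀‖ := by
  have hT := H.time_pos
  have hM := H.bound_nonneg
  set N := M * T ^ q with hN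
  have hN0 : 0 ≤ N := by positivity
  set C := 12 * T * ‖B‖ * ‖ι‖ * N + 4 * δ * N + 1 with hC
  have hC0 : 0 < C := by positivity
  refine ⟨min (1 / (2 * (N + 1))) (δ / C), lt_min (by positivity) (by positivity), C, hC0,
    fun ρ hρ hρ₁ => ?_⟩
  have hsmall : ρ * N ≤ 1 / 2 := by
    have h := (lt_div_iff₀ (by positivity)).1 (hρ₁.trans_le (min_le_left _ _))
    nlinarith
  have hCρ : C * ρ < δ := by
    have h := (lt_div_iff₀ hC0).1 (hρ₁.trans_le (min_le_right _ _))
    linarith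
  have ha : 0 < ‖ι‖ ^ 2 + C * ρ ^ 2 := by positivity
  have hb : 0 < ‖ι‖ ^ 2 + δ * ρ := by positivity
  have hab : ‖ι‖ ^ 2 + C * ρ ^ 2 < ‖ι‖ ^ 2 + δ * ρ := by nlinarith
  set σ := (1 / (2 * T)) * Real.log ((‖ι‖ ^ 2 + δ * ρ) / (‖ι‖ ^ 2 + C * ρ ^ 2)) with hσ
  have hσ0 : 0 < σ := mul_pos (by positivity) (Real.log_pos ((one_lt_div ha).2 hab))
  set θ := (‖ι‖ ^ 2 + C * ρ ^ 2) / (‖ι‖ ^ 2 + δ * ρ) with hθ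
  have hθ0 : 0 < θ := div_pos ha hb
  have hθ1 : θ < 1 := (div_lt_one hb).2 hab
  have hθσ : θ = Real.exp (-(2 * T * σ)) := by
    have : 2 * T * σ = Real.log ((‖ι‖ ^ 2 + δ * ρ) / (‖ι‖ ^ 2 + C * ρ ^ 2)) := by
      rw [hσ]; field_simp
    rw [this, ← Real.log_inv, inv_div, Real.exp_log hθ0]
  -- `V` is an equivalent squared norm on `X` which contracts by the factor `θ` in each period.
  let V : X → ℝ := fun v => ‖ι v‖ ^ 2 + δ * ρ * ‖v‖ ^ 2
  have hV : ∀ v, V v ≤ (‖ι‖ ^ 2 + δ * ρ) * ‖v‖ ^ 2 := fun v => by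
    have : ‖ι v‖ ^ 2 ≤ (‖ι‖ * ‖v‖) ^ 2 := by gcongr; exact ι.le_opNorm v
    simp only [V]
    nlinarith
  have hstep : ∀ (v : X) (x : ℝ → X), IsMildOn ι S F B ρ T v x → V (x T) ≤ θ * V v := by
    intro v x hx
    refine (H.energy_le hρ.le hsmall hδ.le hobs hx).trans ?_
    have h1 : ‖ι v‖ ^ 2 ≤ (‖ι‖ * ‖v‖) ^ 2 := by gcongr; exact ι.le_opNorm v
    have h2 : θ * (‖ι‖ ^ 2 + δ * ρ) = ‖ι‖ ^ 2 + C * ρ ^ 2 := div_mul_cancel₀ _ hb.ne'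
    have h3 : (1 - θ) * ‖ι v‖ ^ 2 ≤ (1 - θ) * (‖ι‖ * ‖v‖) ^ 2 :=
      mul_le_mul_of_nonneg_left h1 (by linarith)
    have h4 : θ * (‖ι‖ ^ 2 + δ * ρ) * ‖v‖ ^ 2 = (‖ι‖ ^ 2 + C * ρ ^ 2) * ‖v‖ ^ 2 := by rw [h2]
    simp only [V]
    nlinarith
  set L := Real.sqrt ((‖ι‖ ^ 2 + δ * ρ) / (δ * ρ)) with hL
  have hL0 : 0 < L := Real.sqrt_pos.2 (by positivity)
  have hL2 : δ * ρ * L ^ 2 = ‖ι‖ ^ 2 + δ * ρ := by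
    rw [hL, Real.sq_sqrt (by positivity)]
    field_simp
  refine ⟨σ, hσ0, rfl, 2 * L * Real.exp (σ * T), by positivity, fun x₀ => ?_⟩
  obtain ⟨x, hx⟩ := H.exists_isMildOn_forall hρ.le hsmall x₀
  refine ⟨x, hx, fun y hy => H.eqOn_of_isMildOn_forall hρ.le hsmall hy hx, fun t ht => ?_⟩
  have hshift : ∀ n : ℕ, IsMildOn ι S F B ρ T (x (n * T)) (fun s => x (n * T + s)) := fun n =>
    H.isMildOn_shift (by positivity) (hx _)
  have hVn : ∀ n : ℕ, V (x (n * T)) ≤ θ ^ n * V x₀ := by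
    intro n
    induction n with
    | zero =>
      rw [Nat.cast_zero, zero_mul, H.apply_zero_of_isMildOn le_rfl (hx 0), pow_zero, one_mul]
    | succ n ih =>
      have h1 := hstep _ _ (hshift n)
      rw [show (n : ℝ) * T + T = (n + 1 : ℕ) * T by push_cast; ring] at h1
      calc V (x ((n + 1 : ℕ) * T)) ≤ θ * V (x (n * T)) := h1
        _ ≤ θ * (θ ^ n * V x₀) := by gcongr
        _ = _ := by ring
  set n := ⌊t / T⌋₊ with hn
  have hn1 : n * T ≤ t := (le_div_iff₀ hT).1 (Nat.floor_le (by positivity))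
  have hn2 : t < (n + 1) * T := (div_lt_iff₀ hT).1 (Nat.lt_floor_add_one _)
  have h1 : ‖x t‖ ≤ 2 * ‖x (n * T)‖ := by
    have := H.norm_le_of_isMildOn hρ.le hsmall (hshift n) (t := t - n * T)
      ⟨by linarith, by linarith⟩
    simpa using this
  have h2 : ‖x (n * T)‖ ≤ L * Real.exp (-(σ * (n * T))) * ‖x₀‖ := by
    refine le_of_sq_le_sq ?_ (by positivity)
    refine le_of_mul_le_mul_left (a := δ * ρ) ?_ (by positivity)
    have e1 : θ ^ n = Real.exp (-(σ * (n * T))) ^ 2 := by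
      rw [hθσ, ← Real.exp_nat_mul, ← Real.exp_nat_mul]
      congr 1
      push_cast
      ring
    calc δ * ρ * ‖x (n * T)‖ ^ 2 ≤ V (x (n * T)) := le_add_of_nonneg_left (by positivity)
      _ ≤ θ ^ n * V x₀ := hVn n
      _ ≤ θ ^ n * ((‖ι‖ ^ 2 + δ * ρ) * ‖x₀‖ ^ 2) := by gcongr; exact hV x₀
      _ = δ * ρ * (L * Real.exp (-(σ * (n * T))) * ‖x₀‖) ^ 2 := by rw [e1, ← hL2]; ring
  -- The last, incomplete period costs at most the factor `exp (σ T)`.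
  have h3 : Real.exp (-(σ * (n * T))) ≤ Real.exp (σ * T) * Real.exp (-σ * t) := by
    rw [← Real.exp_add, Real.exp_le_exp]
    nlinarith
  calc ‖x t‖ ≤ 2 * (L * Real.exp (-(σ * (n * T))) * ‖x₀‖) := by linarith
    _ ≤ 2 * (L * (Real.exp (σ * T) * Real.exp (-σ * t)) * ‖x₀‖) := by gcongr
    _ = _ := by ring

end IsPerturbation

end Decay

/-! ### The extrapolated semigroup -/

section Extrapolated

variable {𝕜 X : Type*} [RCLike 𝕜] [NormedAddCommGroup X] [InnerProductSpace 𝕜 X]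

instance (R : X →L[𝕜] X) : IsScalarTower ℝ 𝕜 (Extrapolation R) :=
  IsScalarTower.of_algebraMap_smul fun _ _ => rfl

theorem continuous_extend (R V : X →L[𝕜] X) : Continuous (extend R V) :=
  UniformSpace.Completion.continuous_map

/-- `extend R V` as a bounded operator, for `V` commuting with `R`. -/
def extendCLM (R V : X →L[𝕜] X) (h : ∀ x, R (V x) = V (R x)) :
    Extrapolation R →L[𝕜] Extrapolation R :=
  LinearMap.mkContinuous
    { toFun := extend R V
      map_add' := fun y z => by
        refine (denseRange_embed R).induction_on₂ (p := fun y z =>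
          extend R V (y + z) = extend R V y + extend R V z) ?_ (fun a b => ?_) y z
        · have hc := continuous_extend R V
          exact isClosed_eq (hc.comp (continuous_fst.add continuous_snd))
            ((hc.comp continuous_fst).add (hc.comp continuous_snd))
        · rw [← map_add, extend_embed h, extend_embed h, extend_embed h, map_add, map_add]
      map_smul' := fun c y => by
        refine (denseRange_embed R).induction_on (p := fun y =>
          extend R V (c • y) = c • extend R V y) y ?_ (fun a => ?_)
        · have hc := continuous_extend R V
          exact isClosed_eq (hc.comp (continuous_const_smul c)) (hc.const_smul c)
        · rw [← map_smul, extend_embed h, extend_embed h, map_smul, map_smul] }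
    ‖V‖ (fun y => by
      refine (denseRange_embed R).induction_on (p := fun y =>
          ‖extend R V y‖ ≤ ‖V‖ * ‖y‖) y ?_ (fun a => ?_)
      · exact isClosed_le (continuous_extend R V).norm (continuous_const.mul continuous_norm)
      · rw [extend_embed h, norm_embed_apply, norm_embed_apply, h]
        exact V.le_opNorm _)

theorem extendCLM_apply (R V : X →L[𝕜] X) (h : ∀ x, R (V x) = V (R x)) (y : Extrapolation R) :
    extendCLM R V h y = extend R V y := rfl

theorem norm_extendCLM_apply_le (R V : X →L[𝕜] X) (h : ∀ x, R (V x) = V (R x))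
    (y : Extrapolation R) : ‖extendCLM R V h y‖ ≤ ‖V‖ * ‖y‖ :=
  ContinuousLinearMap.le_of_opNorm_le _
    (LinearMap.mkContinuous_norm_le _ (norm_nonneg V) _) y

/-- Injectivity comes from that of the resolvent `R`. -/
theorem embed_injective {A : X →ₗ.[𝕜] X} {μ : 𝕜} {R : X →L[𝕜] X} (hR : IsResolvent A μ R) :
    Function.Injective (embed R) := by
  refine (injective_iff_map_eq_zero _).2 fun x hx => ?_
  have h0 : R x = 0 := by rw [← norm_eq_zero, ← norm_embed_apply, hx, norm_zero]
  obtain ⟨h, hx⟩ := hR.1 x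
  have h1 : (⟨R x, h⟩ : A.domain) = 0 := Subtype.ext h0
  rw [h1, h0, smul_zero, A.map_zero, sub_zero] at hx
  exact hx.symm

/-- The semigroup `S₋₁` on the extrapolation space, extended to negative times by the identity. -/
def extrapolatedSemigroup {S : ℝ → X →L[𝕜] X} {R : X →L[𝕜] X}
    (h : ∀ t : ℝ, 0 ≤ t → ∀ x, R (S t x) = S t (R x)) (t : ℝ) :
    Extrapolation R →L[𝕜] Extrapolation R :=
  extendCLM R (S (max t 0)) (h _ (le_max_right t 0))

variable {S : ℝ → X →L[𝕜] X} {R : X →L[𝕜] X}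
  (h : ∀ t : ℝ, 0 ≤ t → ∀ x, R (S t x) = S t (R x))

theorem extrapolatedSemigroup_apply {t : ℝ} (ht : 0 ≤ t) (y : Extrapolation R) :
    extrapolatedSemigroup h t y = extend R (S t) y := by
  rw [extrapolatedSemigroup, extendCLM_apply, max_eq_left ht]

theorem extrapolatedSemigroup_embed (t : ℝ) (x : X) :
    extrapolatedSemigroup h t (embed R x) = embed R (S (max t 0) x) :=
  extend_embed (h _ (le_max_right t 0)) x

theorem isContractionSemigroup_extrapolated (hS : IsC0Semigroup S)
    (hcontr : ∀ t : ℝ, 0 ≤ t → ‖S t‖ ≤ 1) :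
    IsContractionSemigroup (extrapolatedSemigroup h) := by
  have hle : ∀ t y, ‖extrapolatedSemigroup h t y‖ ≤ ‖y‖ := fun t y =>
    (norm_extendCLM_apply_le R (S (max t 0)) _ y).trans
      (mul_le_of_le_one_left (norm_nonneg _) (hcontr _ (le_max_right t 0)))
  refine ⟨fun y => ?_, fun s t hs ht y => ?_, hle, ?_⟩
  · refine (denseRange_embed R).induction_on (p := fun y => extrapolatedSemigroup h 0 y = y) y
      (isClosed_eq (ContinuousLinearMap.continuous _) continuous_id) fun x => ?_
    rw [extrapolatedSemigroup_embed, max_self, hS.map_zero, ContinuousLinearMap.id_apply]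
  · refine (denseRange_embed R).induction_on (p := fun y => extrapolatedSemigroup h (s + t) y =
      extrapolatedSemigroup h s (extrapolatedSemigroup h t y)) y
      (isClosed_eq (ContinuousLinearMap.continuous _)
        ((ContinuousLinearMap.continuous _).comp (ContinuousLinearMap.continuous _))) fun x => ?_
    rw [extrapolatedSemigroup_embed, extrapolatedSemigroup_embed, extrapolatedSemigroup_embed,
      max_eq_left hs, max_eq_left ht, max_eq_left (add_nonneg hs ht), hS.map_add s t hs ht,
      ContinuousLinearMap.comp_apply]
  · -- On the dense range of `embed R` the orbits are continuous; contractivity does the rest.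
    rw [Metric.continuous_iff]
    rintro ⟨t₀, y₀⟩ ε hε
    obtain ⟨x, hx⟩ := Metric.denseRange_iff.1 (denseRange_embed R) y₀ (ε / 4) (by positivity)
    have hc : Continuous fun t => extrapolatedSemigroup h t (embed R x) := by
      simp only [extrapolatedSemigroup_embed]
      exact (embed R).continuous.comp ((hS.continuousOn x).comp_continuous
        (continuous_id.max continuous_const) fun t => le_max_right t 0)
    obtain ⟨η, hη, hη'⟩ := Metric.continuous_iff.1 hc t₀ (ε / 4) (by positivity)
    refine ⟨min η (ε / 4), lt_min hη (by positivity), ?_⟩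
    rintro ⟨t, y⟩ hty
    rw [Prod.dist_eq, max_lt_iff] at hty
    have h1 : dist t t₀ < η := hty.1.trans_le (min_le_left _ _)
    have h2 : dist y y₀ < ε / 4 := hty.2.trans_le (min_le_right _ _)
    have h3 := hη' t h1
    have hlip : ∀ r a b, dist (extrapolatedSemigroup h r a) (extrapolatedSemigroup h r b) ≤
        dist a b := fun r a b => by
      rw [dist_eq_norm, dist_eq_norm, ← map_sub]
      exact hle r _
    have h4 := hlip t y (embed R x)
    have h5 := hlip t₀ (embed R x) y₀
    have h6 := dist_triangle y y₀ (embed R x)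
    have h7 := dist_triangle4 (extrapolatedSemigroup h t y)
      (extrapolatedSemigroup h t (embed R x)) (extrapolatedSemigroup h t₀ (embed R x))
      (extrapolatedSemigroup h t₀ y₀)
    rw [dist_comm (embed R x) y₀] at h5
    change dist (extrapolatedSemigroup h t y) (extrapolatedSemigroup h t₀ y₀) < ε
    linarith

theorem convolution_eq_duhamel (B : X →L[𝕜] Extrapolation R) (u : ℝ → X) {t : ℝ} (ht : 0 ≤ t) :
    convolution S B u t = duhamel (extrapolatedSemigroup h) (fun s => B (u s)) t := by
  refine intervalIntegral.integral_congr fun s hs => ?_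
  rw [uIcc_of_le ht] at hs
  exact (extrapolatedSemigroup_apply h (sub_nonneg.2 hs.2) _).symm

theorem isMildSolution_iff (B : X →L[𝕜] Extrapolation R) (ρ : ℝ) (x₀ : X) (x : ℝ → X) :
    IsMildSolution S B ρ x₀ x ↔
      ∀ a, IsMildOn (embed R) S (extrapolatedSemigroup h) B ρ a x₀ x := by
  constructor
  · rintro ⟨hc, he⟩ a
    refine ⟨hc.mono Icc_subset_Ici_self, fun t ht => ?_⟩
    rw [he t ht.1, convolution_eq_duhamel h B x ht.1]
  · intro H
    refine ⟨fun t ht => ?_, fun t ht => ?_⟩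
    · have h1 := (H (t + 1)).1 t ⟨ht, by linarith⟩
      refine h1.mono_of_mem_nhdsWithin ?_
      rw [← Ici_inter_Iic]
      exact inter_mem_nhdsWithin _ (Iic_mem_nhds (by linarith))
    · rw [convolution_eq_duhamel h B x ht]
      exact (H t).2 t ⟨ht, le_rfl⟩

end Extrapolated

end DeschSchappacher

end

open DeschSchappacher in
theorem theorem2 {𝕜 X : Type*} [RCLike 𝕜] [NormedAddCommGroup X] [InnerProductSpace 𝕜 X]
    [CompleteSpace X]
    (S : ℝ → X →L[𝕜] X) (hS : IsC0Semigroup S) (hcontr : ∀ t : ℝ, 0 ≤ t → ‖S t‖ ≤ 1)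
    (A : X →ₗ.[𝕜] X) (hA : IsGenerator A S)
    (μ : 𝕜) (R : X →L[𝕜] X) (hR : IsResolvent A μ R)
    (B : X →L[𝕜] Extrapolation R)
    (T : ℝ) (hT : 0 < T)
    (p : ℝ≥0∞) (hp : 1 < p) (hp' : p < ∞) (hadm : IsAdmissible S B p T)
    (δ : ℝ) (hδ : 0 < δ)
    (hobs : ∀ x : X, δ * ‖S T x‖ ^ 2 ≤
      ∫ t in (0 : ℝ)..T,
        RCLike.re (inner 𝕜 (S t x) (ContinuousLinearMap.adjoint B (embed R (S t x))))) :
    ∃ ρ₁ : ℝ, 0 < ρ₁ ∧ ∃ C : ℝ, 0 < C ∧ ∀ ρ : ℝ, 0 < ρ → ρ < ρ₁ →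
      ∃ σ : ℝ, 0 < σ ∧
        σ = (1 / (2 * T)) *
          Real.log ((‖embed R‖ ^ 2 + δ * ρ) / (‖embed R‖ ^ 2 + C * ρ ^ 2)) ∧
        IsExponentiallyStable S B ρ σ := by
  have h : ∀ t : ℝ, 0 ≤ t → ∀ x, R (S t x) = S t (R x) := fun t ht x =>
    resolvent_comm hS hA hR ht x
  have hF := isContractionSemigroup_extrapolated h hS hcontr
  obtain ⟨M, hM, q, hq, hb⟩ := hF.exists_duhamelBound (embed_injective hR) B hT.le hp.le hp'
    fun u hu => by
      rw [← convolution_eq_duhamel h B u hT.le]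
      exact hadm u hu
  have H : IsPerturbation (embed R) S (extrapolatedSemigroup h) B T M q :=
    { semigroup := hS
      contraction := hcontr
      extension := hF
      injective := embed_injective hR
      intertwine := fun t ht x => by rw [extrapolatedSemigroup_embed, max_eq_left ht]
      time_pos := hT
      bound_nonneg := hM
      exponent_pos := hq
      bound := hb }
  obtain ⟨ρ₁, hρ₁, C, hC, hmain⟩ := H.exists_decay hδ
    (by simpa only [ContinuousLinearMap.adjoint_inner_right] using hobs)
  refine ⟨ρ₁, hρ₁, C, hC, fun ρ hρ hlt => ?_⟩
  obtain ⟨σ, hσ, hσe, K, hK, hsol⟩ := hmain ρ hρ hlt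
  refine ⟨σ, hσ, hσe, K, hK, fun x₀ => ?_⟩
  simpa only [isMildSolution_iff h] using hsol x₀
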